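/- Let $\mu$ and $\nu$ be Borel probability measures on $\mathbb R$ with finite first moments and $\mu\le_{cx}\nu$, i.e. $\int\varphi\,d\mu\le\int\varphi\,d\nu$ for every convex $\varphi:\mathbb R\to\mathbb R$ (integrals in $(-\infty,\infty]$). Let $M_{mart}(\mu,\nu)$ be the set of martingale transport plans: the probability measures $\pi$ on $\mathbb R\times\mathbb R$ with first marginal $\mu$, second marginal $\nu$, and $\int\rho(x)(y-x)\,d\pi(x,y)=0$ for every bounded continuous $\rho:\mathbb R\to\mathbb R$. Let $c:\mathbb R\times\mathbb R\to[0,\infty)$ be upper semi-continuous, and suppose there are $c_1\in L^1(\mu)$, $c_2\in L^1(\nu)$ and Borel sets $A,B\subseteq\mathbb R$ with $\mu(A)=\nu(B)=1$ such that $c(x,y)\le c_1(x)+c_2(y)$ for all $(x,y)\in A\times B$. For a finite Borel measure $\alpha$ on $\mathbb R\times\mathbb R$, denote by $(\alpha_x)_x$ its disintegration with respect to its first marginal. If $\alpha$ is supported on finitely many points, a competitor of $\alpha$ is a measure $\alpha'$ with the same two marginals as $\alpha$ such that $\int y\,d\alpha_x(y)=\int y\,d\alpha'_x(y)$ for almost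 every $x$ with respect to the first marginal of $\alpha$. A set $\Gamma\subseteq\mathbb R\times\mathbb R$ is $c$-finitely optimal if $\int c\,d\alpha\le\int c\,d\alpha'$ whenever $\alpha$ is a finite measure supported on finitely many points of $\Gamma$ and $\alpha'$ is a competitor of $\alpha$. A plan $\pi\in M_{mart}(\mu,\nu)$ is $c$-finitely optimal if $\pi(\Gamma)=1$ for some Borel $c$-finitely optimal set $\Gamma$. Then every $c$-finitely optimal $\pi\in M_{mart}(\mu,\nu)$ is optimal, that is, $\int c\,d\pi\le\int c\,d\pi'$ for all $\pi'\in M_{mart}(\mu,\nu)$. -/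

import Mathlib

open MeasureTheory
open scoped NNReal ENNReal BoundedContinuousFunction

namespace MartingaleTransport

/-- The convex order `μ ≤_cx ν` of measures on the line: both have a finite first moment, and
`∫ φ dμ ≤ ∫ φ dν` for every convex `φ : ℝ → ℝ`. The integrals take values in `(-∞, ∞]`
(the negative part of a convex function is bounded by an affine function), and the inequality is
void when the right-hand side is `∞`; hence the form of the last condition. -/
def ConvexOrder (μ ν : Measure ℝ) : Prop :=
  Integrable (fun x : ℝ => x) μ ∧ Integrable (fun x : ℝ => x) ν ∧
    ∀ φ : ℝ → ℝ, ConvexOn ℝ Set.univ φ → Integrable φ ν →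
      Integrable φ μ ∧ ∫ x, φ x ∂μ ≤ ∫ x, φ x ∂ν

/-- `π` is a martingale transport plan from `μ` to `ν`: its marginals are `μ` and `ν`, and
`∫ ρ(x) (y - x) dπ(x, y) = 0` for each bounded continuous `ρ`. Integrability of `y - x` makes these
integrals meaningful; it is automatic when `μ` and `ν` have finite first moments. -/
structure IsMartingaleTransport (μ ν : Measure ℝ) (π : Measure (ℝ × ℝ)) : Prop where
  fst_eq : π.fst = μ
  snd_eq : π.snd = ν
  integrable_sub : Integrable (fun p : ℝ × ℝ => p.2 - p.1) π
  integral_eq_zero : ∀ ρ : ℝ →ᵇ ℝ, ∫ p : ℝ × ℝ, ρ p.1 * (p.2 - p.1) ∂π = 0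

/-- `α'` is a competitor of `α`: it has the same marginals, and for almost every `x` (with respect
to the first marginal) the disintegrations satisfy `∫ y dα_x(y) = ∫ y dα'_x(y)`. A measure with the
same marginals as a finite measure is itself finite. -/
structure IsCompetitor (α α' : Measure (ℝ × ℝ)) [IsFiniteMeasure α] [IsFiniteMeasure α'] :
    Prop where
  fst_eq : α'.fst = α.fst
  snd_eq : α'.snd = α.snd
  barycenter_eq : ∀ᵐ x ∂α.fst, ∫ y, y ∂(α.condKernel x) = ∫ y, y ∂(α'.condKernel x)

/-- `Γ` is `c`-finitely optimal: each finite measure supported on finitely many points of `Γ` is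
cost-minimizing among its competitors. -/
def IsFinitelyOptimalSet (c : ℝ × ℝ → ℝ≥0) (Γ : Set (ℝ × ℝ)) : Prop :=
  ∀ (α α' : Measure (ℝ × ℝ)) [IsFiniteMeasure α] [IsFiniteMeasure α'],
    (∃ S : Finset (ℝ × ℝ), (S : Set (ℝ × ℝ)) ⊆ Γ ∧ α (S : Set (ℝ × ℝ))ᶜ = 0) →
    IsCompetitor α α' → ∫⁻ p, (c p : ℝ≥0∞) ∂α ≤ ∫⁻ p, (c p : ℝ≥0∞) ∂α'

/-- A plan `π` (of mass one) is `c`-finitely optimal if it is concentrated on a Borel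
`c`-finitely optimal set. -/
def IsFinitelyOptimal (c : ℝ × ℝ → ℝ≥0) (π : Measure (ℝ × ℝ)) : Prop :=
  ∃ Γ : Set (ℝ × ℝ), MeasurableSet Γ ∧ IsFinitelyOptimalSet c Γ ∧ π Γ = 1

/-- `π` is optimal: it is a martingale transport plan from `μ` to `ν` and minimizes the cost
`∫ c dπ` among all of them. -/
def IsOptimal (c : ℝ × ℝ → ℝ≥0) (μ ν : Measure ℝ) (π : Measure (ℝ × ℝ)) : Prop :=
  IsMartingaleTransport μ ν π ∧
    ∀ π' : Measure (ℝ × ℝ), IsMartingaleTransport μ ν π' →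
      ∫⁻ p, (c p : ℝ≥0∞) ∂π ≤ ∫⁻ p, (c p : ℝ≥0∞) ∂π'

end MartingaleTransport

/-!
Let `π` be concentrated on the `c`-finitely optimal set `Γ`. The proof is by duality: potentials
`φ`, `ψ`, `k` with `φ x + ψ y + k x * (y - x) ≤ c (x, y)`, and equality on `Γ`, show that `π` is
optimal, since the left-hand side should integrate to the same number against every martingale
transport plan. Three points need care.

*Existence of potentials.* Over a finite subset of `Γ` they exist by Farkas' lemma
(`exists_finite_potentials`), because a perturbation of an atomic measure on `Γ` that preserves
marginals and barycenters is a competitor (`IsFinitelyOptimalSet.exists_potentials_finset`). To pass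
to infinite sets one normalises `ψ` at two points and takes limits along an ultrafilter. Bounds
propagate from `x` to `x'` if the open intervals spanned by the fibres `Γ_x` and `Γ_x'` overlap, so
this works over each connected component `I` of the union `Fᶜ` of these intervals
(`IsFinitelyOptimalSet.exists_potentials`).

*Decomposition.* `π` does not cross any level `t ∈ F`. As this is equivalent to
`∫ |y - t| dν = ∫ |x - t| dμ`, every other plan has the same property
(`ae_noCrossing_of_marginals`). Hence all plans agree over `F`, where the mass stays put, and
their restrictions to `I × ℝ` have the same marginals (`snd_restrict_component_eq`), so that it
suffices to compare costs over each `I`.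

*Integrability.* Neither `φ` nor `ψ` need be integrable, and `φ` and `k` are not known to be
measurable; `ψ` is, since it is an infimum of upper semicontinuous functions
(`aemeasurable_potential`). Let `f y = sup_x (φ x - c₁ x + k x * (y - x))`, a convex function, with
subgradients `s` (`exists_moderator`). Up to a multiple `m x * (y - x)`, which integrates to zero
for the conditional measures of a martingale plan, `c₁ x + c₂ y - c (x, y)` is at most
`(c₁ x - φ x + f x) + (c₂ y - ψ y - f y) + (f y - f x - s x * (y - x))`, with equality on `Γ`. All
three terms are nonnegative. The integrals of the first two depend on the marginals only, and so
does that of the Jensen gap (`exists_jensen_gap`), being the limit of the gaps of convex functions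
of linear growth. Thus `π` maximises `∫ (c₁ + c₂ - c)` (`lintegral_cost_le_of_potentials`).
-/

namespace MartingaleTransport

/-! ### Finite linear programming duality -/

/-- **Farkas' lemma** for finitely many linear functionals on a real vector space. -/
theorem farkas {W ι : Type*} [AddCommGroup W] [Module ℝ W] (s : Finset ι) :
    ∀ (A : ι → W →ₗ[ℝ] ℝ) (γ : W →ₗ[ℝ] ℝ),
      (∀ w, (∀ i ∈ s, 0 ≤ A i w) → 0 ≤ γ w) →
      ∃ l : ι → ℝ, (∀ i, 0 ≤ l i) ∧ γ = ∑ i ∈ s, l i • A i := by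
  classical
  induction s using Finset.induction_on with
  | empty =>
    intro A γ h
    refine ⟨0, fun _ => le_rfl, ?_⟩
    ext w
    have h1 := h w (by simp)
    have h2 := h (-w) (by simp)
    rw [map_neg] at h2
    simpa using le_antisymm (by linarith) h1
  | insert a s ha ih =>
    intro A γ h
    by_cases hs : ∀ w, (∀ i ∈ s, 0 ≤ A i w) → 0 ≤ γ w
    · obtain ⟨l, hl, hγ⟩ := ih A γ hs
      refine ⟨fun i => if i = a then 0 else l i, fun i => ?_, ?_⟩
      · dsimp only; split_ifs <;> simp [hl]
      · rw [Finset.sum_insert ha, hγ]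
        simp only [if_true, zero_smul, zero_add]
        refine Finset.sum_congr rfl fun i hi => ?_
        rw [if_neg]
        rintro rfl
        exact ha hi
    · -- Some `w₀` violates `γ ≥ 0`, so `A a w₀ < 0`; project along `w₀` onto the kernel of `A a`.
      push Not at hs
      obtain ⟨w₀, hw₀, hγ₀⟩ := hs
      have ha₀ : A a w₀ < 0 := by
        by_contra hcon
        push Not at hcon
        refine absurd (h w₀ fun i hi => ?_) (not_le.mpr hγ₀)
        rcases Finset.mem_insert.mp hi with rfl | hi
        exacts [hcon, hw₀ i hi]
      obtain ⟨l, hl, hγ⟩ := ih (fun i => A i - (A i w₀ / A a w₀) • A a)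
        (γ - (γ w₀ / A a w₀) • A a) (by
          intro w hw
          have hproj := h (w - (A a w / A a w₀) • w₀) (by
            intro i hi
            rcases Finset.mem_insert.mp hi with rfl | hi
            · simp [div_mul_cancel₀ _ ha₀.ne]
            · have := hw i hi
              simp only [LinearMap.sub_apply, LinearMap.smul_apply, smul_eq_mul, map_sub,
                map_smul] at this ⊢
              convert this using 2
              ring)
          simp only [LinearMap.sub_apply, LinearMap.smul_apply, smul_eq_mul, map_sub,
            map_smul] at hproj ⊢
          convert hproj using 2
          ring)
      have hsum : ∑ i ∈ s, l i * (A i w₀ / A a w₀) ≤ 0 :=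
        Finset.sum_nonpos fun i hi => mul_nonpos_of_nonneg_of_nonpos (hl i)
          (div_nonpos_of_nonneg_of_nonpos (hw₀ i hi) ha₀.le)
      have hpos : 0 < γ w₀ / A a w₀ := div_pos_of_neg_of_neg hγ₀ ha₀
      refine ⟨fun i => if i = a then γ w₀ / A a w₀ - ∑ i ∈ s, l i * (A i w₀ / A a w₀) else l i,
        fun i => ?_, ?_⟩
      · dsimp only; split_ifs
        · linarith
        · exact hl i
      · rw [Finset.sum_insert ha]
        have hcongr : ∑ i ∈ s, (if i = a then γ w₀ / A a w₀ - ∑ i ∈ s, l i * (A i w₀ / A a w₀)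
            else l i) • A i = ∑ i ∈ s, l i • A i := by
          refine Finset.sum_congr rfl fun i hi => ?_
          rw [if_neg]
          rintro rfl
          exact ha hi
        rw [hcongr]
        refine (sub_eq_iff_eq_add.mp hγ).trans ?_
        ext w
        simp only [LinearMap.add_apply, LinearMap.sum_apply, LinearMap.smul_apply,
          LinearMap.sub_apply, smul_eq_mul, mul_sub, Finset.sum_sub_distrib, sub_mul,
          Finset.sum_mul, ↓reduceIte, mul_assoc]
        ring

/-- Farkas' lemma with equality constraints `L k w = 0` next to the inequalities `A i w ≥ 0`. -/
theorem farkas_eq {W ι κ : Type*} [AddCommGroup W] [Module ℝ W] [Finite κ] [Fintype κ]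
    (s : Finset ι) (L : κ → W →ₗ[ℝ] ℝ) (A : ι → W →ₗ[ℝ] ℝ) (γ : W →ₗ[ℝ] ℝ)
    (h : ∀ w, (∀ k, L k w = 0) → (∀ i ∈ s, 0 ≤ A i w) → 0 ≤ γ w) :
    ∃ (m : κ → ℝ) (l : ι → ℝ), (∀ i, 0 ≤ l i) ∧
      γ = ∑ k, m k • L k + ∑ i ∈ s, l i • A i := by
  set K : Submodule ℝ W := ⨅ k, LinearMap.ker (L k) with hK
  have hmem : ∀ w, w ∈ K ↔ ∀ k, L k w = 0 := fun w => by simp [hK, Submodule.mem_iInf]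
  obtain ⟨l, hl, hγ⟩ := farkas s (fun i => (A i).comp K.subtype) (γ.comp K.subtype)
    (fun w hw => h w ((hmem w).mp w.2) hw)
  have hspan : γ - ∑ i ∈ s, l i • A i ∈ Submodule.span ℝ (Set.range L) := by
    refine mem_span_of_iInf_ker_le_ker fun w hw => ?_
    have := LinearMap.congr_fun hγ ⟨w, hw⟩
    simp only [LinearMap.comp_apply, Submodule.subtype_apply, LinearMap.sum_apply,
      LinearMap.smul_apply] at this
    simp [LinearMap.sum_apply, this]
  obtain ⟨m, hm⟩ := (Submodule.mem_span_range_iff_exists_fun ℝ).mp hspan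
  exact ⟨m, l, hl, by rw [hm]; abel⟩

/-- Linear programming duality for martingale transport between finite sets of atoms: if no
perturbation `v` of the weights that preserves marginals and barycenters and is nonnegative off `S`
lowers the cost, then there are dual potentials with contact on `S`. -/
theorem exists_finite_potentials {X Y : Type*} [Fintype X] [Fintype Y] [DecidableEq X]
    [DecidableEq Y] (x : X → ℝ) (y : Y → ℝ) (C : X × Y → ℝ) (S : Set (X × Y))
    (h : ∀ v : X × Y → ℝ, (∀ i, ∑ j, v (i, j) = 0) → (∀ j, ∑ i, v (i, j) = 0) →
      (∀ i, ∑ j, v (i, j) * y j = 0) → (∀ n ∉ S, 0 ≤ v n) → 0 ≤ ∑ n, C n * v n) :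
    ∃ (φ : X → ℝ) (ψ : Y → ℝ) (k : X → ℝ),
      (∀ i j, φ i + ψ j + k i * (y j - x i) ≤ C (i, j)) ∧
      ∀ i j, (i, j) ∈ S → φ i + ψ j + k i * (y j - x i) = C (i, j) := by
  classical
  let e : X × Y → ((X × Y → ℝ) →ₗ[ℝ] ℝ) := fun n => LinearMap.proj n
  let L : X ⊕ Y ⊕ X → ((X × Y → ℝ) →ₗ[ℝ] ℝ) :=
    Sum.elim (fun i => ∑ j, e (i, j))
      (Sum.elim (fun j => ∑ i, e (i, j)) (fun i => ∑ j, y j • e (i, j)))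
  obtain ⟨m, l, hl, hγ⟩ := farkas_eq (Finset.univ.filter (· ∉ S)) L e (∑ n, C n • e n) (by
    intro v hL hA
    have := h v (fun i => by simpa [L, e] using hL (Sum.inl i))
      (fun j => by simpa [L, e] using hL (Sum.inr (Sum.inl j)))
      (fun i => by simpa [L, e, mul_comm] using hL (Sum.inr (Sum.inr i)))
      (fun n hn => hA n (by simpa using hn))
    simpa [e] using this)
  have key : ∀ i j, C (i, j) = m (Sum.inl i) + m (Sum.inr (Sum.inl j)) +
      m (Sum.inr (Sum.inr i)) * y j + if (i, j) ∈ S then 0 else l (i, j) := by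
    intro i j
    have := LinearMap.congr_fun hγ (Pi.single (i, j) 1)
    simp only [LinearMap.sum_apply, LinearMap.smul_apply, LinearMap.add_apply, e, L,
      LinearMap.proj_apply, Fintype.sum_sum_type, Sum.elim_inl, Sum.elim_inr, Pi.single_apply,
      smul_eq_mul, mul_ite, mul_one, mul_zero, Prod.mk.injEq, Finset.sum_ite_eq',
      Finset.sum_filter, Finset.mem_univ, if_true] at this
    rw [this]
    simp only [ite_and, Finset.sum_ite_eq', Finset.mem_univ, if_true,
      Finset.sum_ite_irrel, Finset.sum_const_zero, mul_ite, mul_zero]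
    have h4 : ∑ n : X × Y, (if n ∉ S then l n • (LinearMap.proj n : (X × Y → ℝ) →ₗ[ℝ] ℝ) else 0)
        (Pi.single (i, j) 1) = if (i, j) ∈ S then 0 else l (i, j) := by
      rw [Finset.sum_eq_single (i, j)]
      · by_cases hS : (i, j) ∈ S <;> simp [hS]
      · intro b _ hb
        by_cases hS : b ∈ S <;> simp [hS, hb]
      · simp
    rw [h4]
    ring
  refine ⟨fun i => m (Sum.inl i) + m (Sum.inr (Sum.inr i)) * x i, fun j => m (Sum.inr (Sum.inl j)),
    fun i => m (Sum.inr (Sum.inr i)), fun i j => ?_, fun i j hS => ?_⟩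
  · rw [key i j]
    have : 0 ≤ if (i, j) ∈ S then 0 else l (i, j) := by split_ifs; exacts [le_rfl, hl _]
    linarith
  · rw [key i j, if_pos hS]; ring

/-! ### Finitely supported measures and their competitors -/

/-- The finitely supported measure with weights `w n` at the points `n ∈ N`
(negative weights are truncated to `0`). -/
noncomputable def atomicMeasure (N : Finset (ℝ × ℝ)) (w : ℝ × ℝ → ℝ) : Measure (ℝ × ℝ) :=
  ∑ n ∈ N, ENNReal.ofReal (w n) • Measure.dirac n

section atomic

variable {N : Finset (ℝ × ℝ)} {w w' : ℝ × ℝ → ℝ}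

theorem atomicMeasure_apply (hw : ∀ n, 0 ≤ w n) (E : Set (ℝ × ℝ)) [DecidablePred (· ∈ E)] :
    atomicMeasure N w E = ENNReal.ofReal (∑ n ∈ N, if n ∈ E then w n else 0) := by
  classical
  rw [ENNReal.ofReal_sum_of_nonneg (fun n _ => by split_ifs <;> simp [hw])]
  simp only [atomicMeasure, Measure.finsetSum_apply, Measure.smul_apply, smul_eq_mul]
  refine Finset.sum_congr rfl fun n _ => ?_
  rw [Measure.dirac_apply]
  by_cases h : n ∈ E <;> simp [h]

theorem lintegral_atomicMeasure (f : ℝ × ℝ → ℝ≥0) (hw : ∀ n, 0 ≤ w n) :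
    ∫⁻ p, (f p : ℝ≥0∞) ∂(atomicMeasure N w) = ENNReal.ofReal (∑ n ∈ N, f n * w n) := by
  rw [ENNReal.ofReal_sum_of_nonneg (fun n _ => mul_nonneg (f n).coe_nonneg (hw n))]
  simp only [atomicMeasure, lintegral_finsetSum_measure, lintegral_smul_measure, lintegral_dirac]
  refine Finset.sum_congr rfl fun n _ => ?_
  rw [ENNReal.ofReal_mul (f n).coe_nonneg, smul_eq_mul, mul_comm]
  simp

theorem isFiniteMeasure_atomicMeasure (hw : ∀ n, 0 ≤ w n) : IsFiniteMeasure (atomicMeasure N w) :=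
  ⟨by classical rw [atomicMeasure_apply hw]; exact ENNReal.ofReal_lt_top⟩

theorem integrable_atomicMeasure (f : ℝ × ℝ → ℝ) : Integrable f (atomicMeasure N w) := by
  rw [atomicMeasure, integrable_finsetSum_measure]
  intro n _
  exact (integrable_dirac (by simp)).smul_measure ENNReal.ofReal_ne_top

theorem integral_atomicMeasure (f : ℝ × ℝ → ℝ) (hw : ∀ n, 0 ≤ w n) :
    ∫ p, f p ∂(atomicMeasure N w) = ∑ n ∈ N, w n * f n := by
  have h : ∀ n ∈ N, Integrable f (ENNReal.ofReal (w n) • Measure.dirac n) := fun n _ =>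
    (integrable_dirac (by simp)).smul_measure ENNReal.ofReal_ne_top
  rw [atomicMeasure, integral_finsetSum_measure h]
  refine Finset.sum_congr rfl fun n _ => ?_
  rw [integral_smul_measure, integral_dirac, ENNReal.toReal_ofReal (hw n), smul_eq_mul]

variable {X Y : Finset ℝ}

/-- Equal row sums, column sums and row barycenters of the weights make two atomic measures
competitors. -/
theorem isCompetitor_atomicMeasure (hw : ∀ n, 0 ≤ w n) (hw' : ∀ n, 0 ≤ w' n)
    [IsFiniteMeasure (atomicMeasure (X ×ˢ Y) w)] [IsFiniteMeasure (atomicMeasure (X ×ˢ Y) w')]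
    (hrow : ∀ x ∈ X, ∑ y ∈ Y, w' (x, y) = ∑ y ∈ Y, w (x, y))
    (hcol : ∀ y ∈ Y, ∑ x ∈ X, w' (x, y) = ∑ x ∈ X, w (x, y))
    (hbar : ∀ x ∈ X, ∑ y ∈ Y, w' (x, y) * y = ∑ y ∈ Y, w (x, y) * y) :
    IsCompetitor (atomicMeasure (X ×ˢ Y) w) (atomicMeasure (X ×ˢ Y) w') := by
  classical
  have hfst : (atomicMeasure (X ×ˢ Y) w').fst = (atomicMeasure (X ×ˢ Y) w).fst := by
    ext E hE
    rw [Measure.fst_apply hE, Measure.fst_apply hE, atomicMeasure_apply hw, atomicMeasure_apply hw',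
      Finset.sum_product, Finset.sum_product]
    congr 1
    refine Finset.sum_congr rfl fun x hx => ?_
    by_cases h : x ∈ E <;> simp [h, hrow x hx]
  refine ⟨hfst, ?_, ?_⟩
  · ext E hE
    rw [Measure.snd_apply hE, Measure.snd_apply hE, atomicMeasure_apply hw, atomicMeasure_apply hw',
      Finset.sum_product_right, Finset.sum_product_right]
    congr 1
    refine Finset.sum_congr rfl fun y hy => ?_
    by_cases h : y ∈ E <;> simp [h, hcol y hy]
  · -- The mass of a fibre times its barycenter is the integral of `y` over the fibre.
    have hfib : ∀ u : ℝ × ℝ → ℝ, (∀ n, 0 ≤ u n) → [IsFiniteMeasure (atomicMeasure (X ×ˢ Y) u)] →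
        ∀ x ∈ X, (atomicMeasure (X ×ˢ Y) u).fst.real {x} *
          ∫ y, y ∂((atomicMeasure (X ×ˢ Y) u).condKernel x) = ∑ y ∈ Y, u (x, y) * y := by
      intro u hu _ x hx
      have h := Measure.setIntegral_condKernel_univ_right (ρ := atomicMeasure (X ×ˢ Y) u)
        (f := fun p => p.2) (measurableSet_singleton x) (integrable_atomicMeasure _).integrableOn
      rw [integral_singleton, smul_eq_mul] at h
      rw [h, ← integral_indicator ((measurableSet_singleton x).prod MeasurableSet.univ),
        integral_atomicMeasure _ hu, Finset.sum_product, Finset.sum_eq_single x]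
      · simp
      · intro x' _ hne
        simp [Set.indicator, hne]
      · exact fun h => absurd hx h
    set ρ := (atomicMeasure (X ×ˢ Y) w).fst with hρ
    have hX : ρ (X : Set ℝ)ᶜ = 0 := by
      rw [hρ, Measure.fst_apply (Finset.measurableSet X).compl, atomicMeasure_apply hw,
        ENNReal.ofReal_eq_zero]
      refine (Finset.sum_eq_zero fun n hn => ?_).le
      simp [(Finset.mem_product.mp hn).1]
    have hnull : ρ (⋃ x ∈ X.filter (fun x => ρ {x} = 0), {x}) = 0 :=
      (measure_biUnion_null_iff (Finset.countable_toSet _)).mpr fun x hx =>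
        (Finset.mem_filter.mp hx).2
    refine measure_mono_null (fun x hx => ?_) (measure_union_null hX hnull)
    by_cases hxX : x ∈ X
    · refine Or.inr (Set.mem_biUnion (Finset.mem_filter.mpr ⟨hxX, ?_⟩) rfl)
      by_contra h0
      refine hx (mul_left_cancel₀ (a := ρ.real {x}) ?_ ?_)
      · exact (ENNReal.toReal_pos h0 (measure_ne_top _ _)).ne'
      · rw [hρ, hfib w hw x hxX, ← hbar x hxX, ← hfib w' hw' x hxX, hfst]
    · exact Or.inl hxX

end atomic

/-- A finitely optimal set carries dual potentials over each of its finite subsets. -/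
theorem IsFinitelyOptimalSet.exists_potentials_finset {c : ℝ × ℝ → ℝ≥0} {Γ : Set (ℝ × ℝ)}
    (hΓ : IsFinitelyOptimalSet c Γ) (S : Finset (ℝ × ℝ)) (hS : (S : Set (ℝ × ℝ)) ⊆ Γ) :
    ∃ φ ψ k : ℝ → ℝ, (∀ p ∈ S, ∀ q ∈ S, φ p.1 + ψ q.2 + k p.1 * (q.2 - p.1) ≤ c (p.1, q.2)) ∧
      ∀ p ∈ S, φ p.1 + ψ p.2 + k p.1 * (p.2 - p.1) = c p := by
  classical
  set X := S.image Prod.fst with hX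
  set Y := S.image Prod.snd with hY
  have memX : ∀ {p}, p ∈ S → p.1 ∈ X := fun h => Finset.mem_image_of_mem _ h
  have memY : ∀ {p}, p ∈ S → p.2 ∈ Y := fun h => Finset.mem_image_of_mem _ h
  obtain ⟨φ, ψ, k, hle, heq⟩ := exists_finite_potentials (X := X) (Y := Y) (fun x => x) (fun y => y)
    (fun n => (c (n.1, n.2) : ℝ)) {n | ((n.1 : ℝ), (n.2 : ℝ)) ∈ S} (by
      intro v hrow hcol hbar hpos
      -- Extend `v` by zero to the plane; `t` is large enough for `t + v ≥ 0` on `S`.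
      set u : ℝ × ℝ → ℝ := fun p =>
        if h : p.1 ∈ X ∧ p.2 ∈ Y then v (⟨p.1, h.1⟩, ⟨p.2, h.2⟩) else 0 with hu
      have huv : ∀ (i : X) (j : Y), u (i, j) = v (i, j) := fun i j => by simp [hu]
      set t : ℝ := ∑ p ∈ S, |u p| with ht
      have ht0 : 0 ≤ t := Finset.sum_nonneg fun _ _ => abs_nonneg _
      set w : ℝ × ℝ → ℝ := fun p => if p ∈ S then t else 0 with hwdef
      have hw : ∀ p, 0 ≤ w p := fun p => by simp only [hwdef]; split_ifs <;> simp [ht0]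
      have hw' : ∀ p, 0 ≤ w p + u p := by
        intro p
        by_cases hp : p ∈ S
        · have h1 : |u p| ≤ t := Finset.single_le_sum (f := fun p => |u p|)
            (fun _ _ => abs_nonneg _) hp
          simp only [hwdef, if_pos hp]
          linarith [neg_abs_le (u p)]
        · simp only [hwdef, if_neg hp, hu, zero_add]
          split_ifs with h
          · exact hpos _ hp
          · exact le_rfl
      have := isFiniteMeasure_atomicMeasure (N := X ×ˢ Y) hw
      have := isFiniteMeasure_atomicMeasure (N := X ×ˢ Y) hw'
      have hrow' : ∀ x ∈ X, ∑ y ∈ Y, u (x, y) = 0 := fun x hx => by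
        rw [← Finset.sum_coe_sort Y, ← hrow ⟨x, hx⟩]
        exact Finset.sum_congr rfl fun j _ => huv ⟨x, hx⟩ j
      have hcol' : ∀ y ∈ Y, ∑ x ∈ X, u (x, y) = 0 := fun y hy => by
        rw [← Finset.sum_coe_sort X, ← hcol ⟨y, hy⟩]
        exact Finset.sum_congr rfl fun i _ => huv i ⟨y, hy⟩
      have hbar' : ∀ x ∈ X, ∑ y ∈ Y, u (x, y) * y = 0 := fun x hx => by
        rw [← Finset.sum_coe_sort Y, ← hbar ⟨x, hx⟩]
        exact Finset.sum_congr rfl fun j _ => by rw [← huv ⟨x, hx⟩ j]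
      have hopt := hΓ (atomicMeasure (X ×ˢ Y) w) (atomicMeasure (X ×ˢ Y) (fun p => w p + u p))
        ⟨S, hS, by
          rw [atomicMeasure_apply hw, ENNReal.ofReal_eq_zero]
          refine (Finset.sum_eq_zero fun n _ => ?_).le
          by_cases hn : n ∈ S <;> simp [hwdef, hn]⟩
        (isCompetitor_atomicMeasure hw hw'
          (fun x hx => by simp [Finset.sum_add_distrib, hrow' x hx])
          (fun y hy => by simp [Finset.sum_add_distrib, hcol' y hy])
          (fun x hx => by simp [Finset.sum_add_distrib, add_mul, hbar' x hx]))
      rw [lintegral_atomicMeasure _ hw, lintegral_atomicMeasure _ hw',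
        ENNReal.ofReal_le_ofReal_iff (Finset.sum_nonneg fun n _ =>
          mul_nonneg (c n).coe_nonneg (hw' n))] at hopt
      simp only [mul_add, Finset.sum_add_distrib, le_add_iff_nonneg_right] at hopt
      rw [Finset.sum_product, ← Finset.sum_coe_sort X] at hopt
      rw [Fintype.sum_prod_type]
      refine hopt.trans_eq (Finset.sum_congr rfl fun i _ => ?_)
      rw [← Finset.sum_coe_sort Y]
      exact Finset.sum_congr rfl fun j _ => by rw [huv])
  refine ⟨fun x => if h : x ∈ X then φ ⟨x, h⟩ else 0, fun y => if h : y ∈ Y then ψ ⟨y, h⟩ else 0,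
    fun x => if h : x ∈ X then k ⟨x, h⟩ else 0, fun p hp q hq => ?_, fun p hp => ?_⟩
  · simpa only [dif_pos (memX hp), dif_pos (memY hq)] using hle ⟨p.1, memX hp⟩ ⟨q.2, memY hq⟩
  · simpa only [dif_pos (memX hp), dif_pos (memY hp)] using
      heq ⟨p.1, memX hp⟩ ⟨p.2, memY hp⟩ hp

/-! ### Dual potentials on a finitely optimal set -/

open Filter in
/-- Real functions that are eventually bounded above along a filter. -/
def EvBddAbove {ι : Type*} (l : Filter ι) (u : ι → ℝ) : Prop := ∃ M, ∀ᶠ i in l, u i ≤ M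

section EvBdd

open Filter

variable {ι : Type*} {l : Filter ι} {u v : ι → ℝ}

theorem EvBddAbove.add (hu : EvBddAbove l u) (hv : EvBddAbove l v) :
    EvBddAbove l (fun i => u i + v i) := by
  obtain ⟨M, hM⟩ := hu
  obtain ⟨M', hM'⟩ := hv
  exact ⟨M + M', by filter_upwards [hM, hM'] with i h h' using add_le_add h h'⟩

theorem EvBddAbove.const_mul (hu : EvBddAbove l u) {a : ℝ} (ha : 0 ≤ a) :
    EvBddAbove l (fun i => a * u i) := by
  obtain ⟨M, hM⟩ := hu
  exact ⟨a * M, by filter_upwards [hM] with i h using mul_le_mul_of_nonneg_left h ha⟩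

theorem evBddAbove_const (a : ℝ) : EvBddAbove l (fun _ => a) := ⟨a, by simp⟩

theorem EvBddAbove.congr_le (hu : EvBddAbove l u) (h : ∀ᶠ i in l, v i ≤ u i) : EvBddAbove l v := by
  obtain ⟨M, hM⟩ := hu
  exact ⟨M, by filter_upwards [hM, h] with i h h' using h'.trans h⟩

/-- Affine functions of `t` bounded above at `z₁ ≤ z₂` are bounded above in between. -/
theorem EvBddAbove.affine {a b : ι → ℝ} {z₁ z₂ t : ℝ}
    (h₁ : EvBddAbove l (fun i => a i + b i * z₁)) (h₂ : EvBddAbove l (fun i => a i + b i * z₂))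
    (hz₁ : z₁ ≤ t) (hz₂ : t ≤ z₂) : EvBddAbove l (fun i => a i + b i * t) := by
  rcases (hz₁.trans hz₂).eq_or_lt with h | h
  · rwa [le_antisymm (h ▸ hz₂) hz₁]
  · have h0 : 0 < z₂ - z₁ := sub_pos.mpr h
    refine ((h₁.const_mul (div_nonneg (sub_nonneg.mpr hz₂) h0.le)).add
      (h₂.const_mul (div_nonneg (sub_nonneg.mpr hz₁) h0.le))).congr_le (Eventually.of_forall ?_)
    intro i
    apply le_of_eq
    field_simp
    ring

/-- Affine functions of `t` bounded above at `z` and below at `x` are bounded below on the side of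
`x` away from `z`. -/
theorem EvBddAbove.affine_neg {a b : ι → ℝ} {z x t : ℝ}
    (hz : EvBddAbove l (fun i => a i + b i * z))
    (hx : EvBddAbove l (fun i => -a i + -b i * x)) (h : 0 < (x - z) * (t - x)) :
    EvBddAbove l (fun i => -a i + -b i * t) := by
  have hxz : x - z ≠ 0 := fun h0 => by simp [h0] at h
  have hdiv : 0 < (t - x) / (x - z) := by
    rw [← mul_div_mul_left _ _ hxz]
    exact div_pos h (mul_self_pos.mpr hxz)
  refine ((hz.const_mul hdiv.le).add
    (hx.const_mul (a := (t - x) / (x - z) + 1) (by linarith))).congr_le (Eventually.of_forall ?_)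
  intro i
  apply le_of_eq
  field_simp
  ring

/-- Affine functions of `t` bounded at two points are bounded everywhere. -/
theorem EvBddAbove.affine_extrapolate {a b : ι → ℝ} {s₁ s₂ : ℝ} (hs : s₁ < s₂)
    (h₁ : EvBddAbove l (fun i => a i + b i * s₁)) (h₁' : EvBddAbove l (fun i => -a i + -b i * s₁))
    (h₂ : EvBddAbove l (fun i => a i + b i * s₂)) (h₂' : EvBddAbove l (fun i => -a i + -b i * s₂))
    (t : ℝ) : EvBddAbove l (fun i => a i + b i * t) ∧ EvBddAbove l (fun i => -a i + -b i * t) := by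
  have key : ∀ a b : ι → ℝ, EvBddAbove l (fun i => a i + b i * s₁) →
      EvBddAbove l (fun i => -a i + -b i * s₁) → EvBddAbove l (fun i => a i + b i * s₂) →
      EvBddAbove l (fun i => -a i + -b i * s₂) → EvBddAbove l (fun i => a i + b i * t) := by
    intro a b h₁ h₁' h₂ h₂'
    rcases lt_or_ge t s₁ with ht | ht
    · have := EvBddAbove.affine_neg (a := fun i => -a i) (b := fun i => -b i) (t := t) h₂'
        (by simpa using h₁) (by nlinarith)
      simpa using this
    · rcases le_or_gt t s₂ with ht' | ht'
      · exact h₁.affine h₂ ht ht'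
      · have := EvBddAbove.affine_neg (a := fun i => -a i) (b := fun i => -b i) (t := t) h₁'
          (by simpa using h₂) (by nlinarith)
        simpa using this
  exact ⟨key a b h₁ h₁' h₂ h₂', key (fun i => -a i) (fun i => -b i) h₁' (by simpa using h₁) h₂'
    (by simpa using h₂)⟩

theorem exists_tendsto_of_evBddAbove {𝒰 : Ultrafilter ι} (h : EvBddAbove (𝒰 : Filter ι) u)
    (h' : EvBddAbove (𝒰 : Filter ι) (fun i => -u i)) : ∃ a, Tendsto u 𝒰 (nhds a) := by
  obtain ⟨M, hM⟩ := h
  obtain ⟨M', hM'⟩ := h'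
  have hmem : ∀ᶠ i in (𝒰 : Filter ι), u i ∈ Set.Icc (-M') M := by
    filter_upwards [hM, hM'] with i hi hi' using ⟨by linarith, hi⟩
  obtain ⟨a, -, ha⟩ := isCompact_Icc.ultrafilter_le_nhds' (𝒰.map u) hmem
  exact ⟨a, ha⟩

end EvBdd

/-- The open interval spanned by the fibre `G_x`. -/
def fibreHull (G : Set (ℝ × ℝ)) (x : ℝ) : Set ℝ :=
  {t | ∃ y₁ y₂, (x, y₁) ∈ G ∧ (x, y₂) ∈ G ∧ y₁ < t ∧ t < y₂}

theorem isOpen_fibreHull (G : Set (ℝ × ℝ)) (x : ℝ) : IsOpen (fibreHull G x) := by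
  have : fibreHull G x = ⋃ (y₁) (y₂) (_ : (x, y₁) ∈ G) (_ : (x, y₂) ∈ G), Set.Ioo y₁ y₂ := by
    ext t
    simp only [fibreHull, Set.mem_ofPred_eq, Set.mem_iUnion, Set.mem_Ioo, exists_prop]
  rw [this]
  exact isOpen_iUnion fun _ => isOpen_iUnion fun _ => isOpen_iUnion fun _ => isOpen_iUnion fun _ =>
    isOpen_Ioo

/-- Dual potentials exist on a subset of a finitely optimal set whose fibre hulls cover a connected
set: the normalised potentials of the finite subsets stay bounded at each point, because bounds
propagate between overlapping fibre hulls, and their limit along an ultrafilter does the job. -/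
theorem IsFinitelyOptimalSet.exists_potentials {c : ℝ × ℝ → ℝ≥0} {Γ G : Set (ℝ × ℝ)} {I : Set ℝ}
    (hΓ : IsFinitelyOptimalSet c Γ) (hG : G ⊆ Γ) (hI : IsPreconnected I) (hne : I.Nonempty)
    (hcov : ∀ t ∈ I, ∃ x, t ∈ fibreHull G x) (hGI : ∀ p ∈ G, p.1 ∈ I)
    (hdiag : ∀ p ∈ G, p.1 ∈ fibreHull G p.1 ∨ p.2 = p.1) :
    ∃ φ ψ k : ℝ → ℝ, (∀ p ∈ G, ∀ q ∈ G, φ p.1 + ψ q.2 + k p.1 * (q.2 - p.1) ≤ c (p.1, q.2)) ∧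
      ∀ p ∈ G, φ p.1 + ψ p.2 + k p.1 * (p.2 - p.1) = c p := by
  classical
  obtain ⟨t₀, ht₀⟩ := hne
  obtain ⟨x₀, z₁, z₂, hz₁, hz₂, hzt₁, hzt₂⟩ := hcov t₀ ht₀
  have hz : z₁ < z₂ := hzt₁.trans hzt₂
  -- Potentials of the finite subsets, normalised by `ψ z₁ = ψ z₂ = 0`; `a + b t` is the affine
  -- function `φ x + k x * (t - x)`.
  have hfin : ∀ S : Finset G, ∃ a b ψ : ℝ → ℝ, ψ z₁ = 0 ∧ ψ z₂ = 0 ∧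
      (∀ p ∈ S, ∀ q ∈ S, a p.1.1 + b p.1.1 * q.1.2 + ψ q.1.2 ≤ c (p.1.1, q.1.2)) ∧
      ∀ p ∈ S, a p.1.1 + b p.1.1 * p.1.2 + ψ p.1.2 = c p.1 := by
    intro S
    obtain ⟨φ, ψ, k, hle, heq⟩ := hΓ.exists_potentials_finset (S.map (Function.Embedding.subtype _))
      (by intro p hp; simp at hp; exact hG hp.1)
    obtain ⟨β, α, h₁, h₂⟩ : ∃ β α : ℝ, ψ z₁ - (α + β * z₁) = 0 ∧ ψ z₂ - (α + β * z₂) = 0 := by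
      have h0 : z₂ - z₁ ≠ 0 := (sub_pos.mpr hz).ne'
      refine ⟨(ψ z₂ - ψ z₁) / (z₂ - z₁), ψ z₁ - (ψ z₂ - ψ z₁) / (z₂ - z₁) * z₁, by ring, ?_⟩
      field_simp
      ring
    refine ⟨fun x => φ x - k x * x + α, fun x => k x + β, fun y => ψ y - (α + β * y), h₁, h₂,
      fun p hp q hq => ?_, fun p hp => ?_⟩
    · have := hle p.1 (Finset.mem_map_of_mem _ hp) q.1 (Finset.mem_map_of_mem _ hq)
      linarith
    · have := heq p.1 (Finset.mem_map_of_mem _ hp)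
      linarith
  choose a b ψ hψ₁ hψ₂ hle heq using hfin
  set 𝒰 : Ultrafilter (Finset G) := Ultrafilter.of Filter.atTop with h𝒰
  have hmem : ∀ p : G, ∀ᶠ S in (𝒰 : Filter (Finset G)), p ∈ S := fun p =>
    (Ultrafilter.of_le _) ((Filter.eventually_ge_atTop {p}).mono fun S hS => hS (by simp))
  have hle' : ∀ {x y y' x'}, (x, y') ∈ G → (x', y) ∈ G →
      ∀ᶠ S in (𝒰 : Filter (Finset G)), a S x + b S x * y + ψ S y ≤ c (x, y) := by
    intro x y y' x' h h'
    filter_upwards [hmem ⟨_, h⟩, hmem ⟨_, h'⟩] with S hS hS' using hle S _ hS _ hS'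
  have heq' : ∀ {x y}, (x, y) ∈ G →
      ∀ᶠ S in (𝒰 : Filter (Finset G)), a S x + b S x * y + ψ S y = c (x, y) := by
    intro x y h
    filter_upwards [hmem ⟨_, h⟩] with S hS using heq S _ hS
  -- `T x`: the affine functions at `x` stay bounded.
  set T : ℝ → Prop := fun x => ∀ t,
    EvBddAbove (𝒰 : Filter (Finset G)) (fun S => a S x + b S x * t) ∧
    EvBddAbove (𝒰 : Filter (Finset G)) (fun S => -a S x + -b S x * t) with hT
  have hTψ : ∀ {x y}, T x → (x, y) ∈ G → EvBddAbove (𝒰 : Filter (Finset G)) (fun S => ψ S y) ∧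
      EvBddAbove (𝒰 : Filter (Finset G)) (fun S => -ψ S y) := by
    intro x y hx h
    refine ⟨((evBddAbove_const (c (x, y) : ℝ)).add (hx y).2).congr_le ?_,
      ((evBddAbove_const (-(c (x, y) : ℝ))).add (hx y).1).congr_le ?_⟩ <;>
    · filter_upwards [heq' h] with S hS
      linarith
  have hT₀ : T x₀ := by
    have h₁ : ∀ᶠ S in (𝒰 : Filter (Finset G)), a S x₀ + b S x₀ * z₁ = c (x₀, z₁) :=
      (heq' hz₁).mono fun S hS => by rw [← hS, hψ₁, add_zero]
    have h₂ : ∀ᶠ S in (𝒰 : Filter (Finset G)), a S x₀ + b S x₀ * z₂ = c (x₀, z₂) :=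
      (heq' hz₂).mono fun S hS => by rw [← hS, hψ₂, add_zero]
    refine fun t => EvBddAbove.affine_extrapolate hz ((evBddAbove_const _).congr_le
      (h₁.mono fun S hS => hS.le)) ((evBddAbove_const (-(c (x₀, z₁) : ℝ))).congr_le
      (h₁.mono fun S hS => ?_)) ((evBddAbove_const _).congr_le
      (h₂.mono fun S hS => hS.le)) ((evBddAbove_const (-(c (x₀, z₂) : ℝ))).congr_le
      (h₂.mono fun S hS => ?_)) t <;> linarith
  have hup : ∀ {x y x' y'}, T x' → (x', y') ∈ G → (x, y) ∈ G →
      EvBddAbove (𝒰 : Filter (Finset G)) (fun S => a S x + b S x * y') := by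
    intro x y x' y' hx' h' h
    refine ((evBddAbove_const (c (x, y') : ℝ)).add (hTψ hx' h').2).congr_le ?_
    filter_upwards [hle' h h'] with S hS
    linarith
  have hup₀ : ∀ {x y}, (x, y) ∈ G → EvBddAbove (𝒰 : Filter (Finset G)) (fun S => ψ S y) := by
    intro x y h
    refine ((evBddAbove_const (c (x₀, y) : ℝ)).add (hT₀ y).2).congr_le ?_
    filter_upwards [hle' hz₁ h] with S hS
    linarith
  have hlow : ∀ {x y}, (x, y) ∈ G →
      EvBddAbove (𝒰 : Filter (Finset G)) (fun S => -a S x + -b S x * y) := by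
    intro x y h
    refine ((evBddAbove_const (-(c (x, y) : ℝ))).add (hup₀ h)).congr_le ?_
    filter_upwards [heq' h] with S hS
    linarith
  have hstep : ∀ {x x' t}, T x' → t ∈ fibreHull G x' → t ∈ fibreHull G x → T x := by
    rintro x x' t hx' ⟨w₁, w₂, hw₁, hw₂, hwt₁, hwt₂⟩ ⟨y₁, y₂, hy₁, hy₂, hyt₁, hyt₂⟩
    have hs : max w₁ y₁ < min w₂ y₂ :=
      (max_lt hwt₁ hyt₁).trans (lt_min hwt₂ hyt₂)
    exact EvBddAbove.affine_extrapolate hs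
      ((hup hx' hw₁ hy₁).affine (hup hx' hw₂ hy₁) (le_max_left _ _)
        (hs.le.trans (min_le_left _ _)))
      ((hlow hy₁).affine (hlow hy₂) (le_max_right _ _) (hs.le.trans (min_le_right _ _)))
      ((hup hx' hw₁ hy₁).affine (hup hx' hw₂ hy₁) ((le_max_left _ _).trans hs.le)
        (min_le_left _ _))
      ((hlow hy₁).affine (hlow hy₂) ((le_max_right _ _).trans hs.le) (min_le_right _ _))
  have hTall : ∀ {x t}, t ∈ I → t ∈ fibreHull G x → T x := by
    intro x t ht htx
    by_contra hx
    obtain ⟨s, -, hs₁, hs₂⟩ := hI (⋃ (x') (_ : T x'), fibreHull G x')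
      (⋃ (x') (_ : ¬ T x'), fibreHull G x')
      (isOpen_iUnion fun _ => isOpen_iUnion fun _ => isOpen_fibreHull _ _)
      (isOpen_iUnion fun _ => isOpen_iUnion fun _ => isOpen_fibreHull _ _)
      (fun s hs => by
        obtain ⟨x', hx'⟩ := hcov s hs
        by_cases hTx : T x'
        · exact Or.inl (Set.mem_biUnion hTx hx')
        · exact Or.inr (Set.mem_biUnion (s := {x' | ¬ T x'}) hTx hx'))
      ⟨t₀, ht₀, Set.mem_biUnion hT₀ ⟨z₁, z₂, hz₁, hz₂, hzt₁, hzt₂⟩⟩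
      ⟨t, ht, Set.mem_biUnion (s := {x' | ¬ T x'}) hx htx⟩
    simp only [Set.mem_iUnion] at hs₁ hs₂
    obtain ⟨x₁, hT₁, h₁⟩ := hs₁
    obtain ⟨x₂, hT₂, h₂⟩ := hs₂
    exact hT₂ (hstep hT₁ h₁ h₂)
  have hTG : ∀ {x y}, (x, y) ∈ G → T x := by
    intro x y h
    rcases hdiag _ h with hx | hx
    · exact hTall (hGI _ h) hx
    · -- Only the diagonal point is in contact; use a fibre hull around `x`.
      dsimp only at hx
      subst hx
      obtain ⟨x', hx'⟩ := hcov _ (hGI _ h)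
      have hTx' := hTall (hGI _ h) hx'
      obtain ⟨w₁, w₂, hw₁, hw₂, hwt₁, hwt₂⟩ := hx'
      dsimp only at hwt₁ hwt₂
      have u₁ := hup hTx' hw₁ h
      have u₂ := hup hTx' hw₂ h
      have l₀ := hlow h
      exact EvBddAbove.affine_extrapolate (hwt₁.trans hwt₂) u₁
        (u₂.affine_neg l₀ (by nlinarith)) u₂ (u₁.affine_neg l₀ (by nlinarith))
  have hA : ∀ x, ∃ a' b' : ℝ, (∃ y, (x, y) ∈ G) → ∀ t,
      Filter.Tendsto (fun S => a S x + b S x * t) 𝒰 (nhds (a' + b' * t)) := by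
    intro x
    by_cases h : ∃ y, (x, y) ∈ G
    · obtain ⟨y, h⟩ := h
      have hlim := fun t => exists_tendsto_of_evBddAbove (𝒰 := 𝒰) (hTG h t).1
        (((hTG h t).2).congr_le (Filter.Eventually.of_forall fun S => by linarith))
      obtain ⟨a₀, ha₀⟩ := hlim 0
      obtain ⟨a₁, ha₁⟩ := hlim 1
      refine ⟨a₀, a₁ - a₀, fun _ t => ?_⟩
      have := ha₀.add ((ha₁.sub ha₀).mul_const t)
      refine this.congr fun S => ?_
      ring
    · exact ⟨0, 0, fun h' => absurd h' h⟩
  have hB : ∀ y, ∃ ψ' : ℝ, (∃ x, (x, y) ∈ G) → Filter.Tendsto (fun S => ψ S y) 𝒰 (nhds ψ') := by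
    intro y
    by_cases h : ∃ x, (x, y) ∈ G
    · obtain ⟨x, h⟩ := h
      obtain ⟨ψ', hψ'⟩ := exists_tendsto_of_evBddAbove (𝒰 := 𝒰) (hTψ (hTG h) h).1 (hTψ (hTG h) h).2
      exact ⟨ψ', fun _ => hψ'⟩
    · exact ⟨0, fun h' => absurd h' h⟩
  choose a' b' hab using hA
  choose ψ' hψ' using hB
  refine ⟨fun x => a' x + b' x * x, ψ', b', fun p hp q hq => ?_, fun p hp => ?_⟩
  · have := le_of_tendsto ((hab p.1 ⟨_, hp⟩ q.2).add (hψ' q.2 ⟨_, hq⟩)) (hle' hp hq)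
    linarith
  · have := tendsto_nhds_unique ((hab p.1 ⟨_, hp⟩ p.2).add (hψ' p.2 ⟨_, hp⟩))
      (tendsto_const_nhds.congr' ((heq' hp).mono fun S hS => hS.symm))
    linarith

/-! ### Martingale measures and the levels they do not cross -/

/-- The martingale property of a measure on the plane: the mean of `y - x` vanishes on each
vertical strip `E × ℝ`. -/
structure IsMartingaleMeasure (π : Measure (ℝ × ℝ)) : Prop where
  integrable_sub : Integrable (fun p : ℝ × ℝ => p.2 - p.1) π
  setIntegral_eq_zero : ∀ E, MeasurableSet E → ∫ p in E ×ˢ Set.univ, (p.2 - p.1) ∂π = 0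

theorem isMartingaleMeasure_of_condKernel {π : Measure (ℝ × ℝ)} [IsFiniteMeasure π]
    (hint : Integrable (fun p : ℝ × ℝ => p.2 - p.1) π)
    (h : ∀ᵐ x ∂π.fst, ∫ y, (y - x) ∂(π.condKernel x) = 0) : IsMartingaleMeasure π := by
  refine ⟨hint, fun E hE => ?_⟩
  rw [← Measure.setIntegral_condKernel_univ_right hE hint.integrableOn]
  exact integral_eq_zero_of_ae (ae_restrict_of_ae h)

theorem IsMartingaleTransport.isMartingaleMeasure {μ ν : Measure ℝ} {π : Measure (ℝ × ℝ)}
    [IsFiniteMeasure π] (hπ : IsMartingaleTransport μ ν π) : IsMartingaleMeasure π := by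
  refine isMartingaleMeasure_of_condKernel hπ.integrable_sub ?_
  refine ae_eq_zero_of_integral_contDiff_smul_eq_zero
    (hπ.integrable_sub.integral_condKernel.locallyIntegrable) fun g hg hsupp => ?_
  obtain ⟨C, hC⟩ := hsupp.exists_bound_of_continuous hg.continuous
  have h := hπ.integral_eq_zero
    (BoundedContinuousFunction.ofNormedAddCommGroup g hg.continuous C hC)
  simp only [BoundedContinuousFunction.coe_ofNormedAddCommGroup] at h
  have hint : Integrable (fun p : ℝ × ℝ => g p.1 * (p.2 - p.1)) π :=
    hπ.integrable_sub.bdd_mul (c := C) (hg.continuous.comp continuous_fst).aestronglyMeasurable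
      (Filter.Eventually.of_forall fun p => hC p.1)
  rw [← Measure.integral_condKernel hint] at h
  simpa only [integral_const_mul, smul_eq_mul] using h

namespace IsMartingaleMeasure

variable {π π' : Measure (ℝ × ℝ)}

theorem restrict (hπ : IsMartingaleMeasure π) {I : Set ℝ} (hI : MeasurableSet I) :
    IsMartingaleMeasure (π.restrict (I ×ˢ Set.univ)) := by
  refine ⟨hπ.integrable_sub.restrict, fun E hE => ?_⟩
  rw [Measure.restrict_restrict (hE.prod MeasurableSet.univ), Set.prod_inter_prod, Set.univ_inter]
  exact hπ.setIntegral_eq_zero _ (hE.inter hI)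

theorem ae_integral_condKernel [IsFiniteMeasure π] (hπ : IsMartingaleMeasure π) :
    ∀ᵐ x ∂π.fst, ∫ y, (y - x) ∂(π.condKernel x) = 0 := by
  refine (hπ.integrable_sub.integral_condKernel).ae_eq_zero_of_forall_setIntegral_eq_zero
    fun E hE _ => ?_
  rw [Measure.setIntegral_condKernel_univ_right hE hπ.integrable_sub.integrableOn]
  exact hπ.setIntegral_eq_zero E hE

theorem integral_mul_eq_zero [IsFiniteMeasure π] (hπ : IsMartingaleMeasure π) {σ : ℝ → ℝ}
    (hσ : Measurable σ) {C : ℝ} (hC : ∀ x, |σ x| ≤ C) :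
    Integrable (fun p : ℝ × ℝ => σ p.1 * (p.2 - p.1)) π ∧
      ∫ p, σ p.1 * (p.2 - p.1) ∂π = 0 := by
  have hint : Integrable (fun p : ℝ × ℝ => σ p.1 * (p.2 - p.1)) π :=
    hπ.integrable_sub.bdd_mul (c := C) (hσ.comp measurable_fst).aestronglyMeasurable
      (Filter.Eventually.of_forall fun p => hC p.1)
  refine ⟨hint, ?_⟩
  rw [← Measure.integral_condKernel hint]
  refine integral_eq_zero_of_ae ?_
  filter_upwards [hπ.ae_integral_condKernel] with x hx
  simp [integral_const_mul, hx]

end IsMartingaleMeasure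

/-- The mass at `p` does not move across the level `t`. -/
def NoCrossing (t : ℝ) (p : ℝ × ℝ) : Prop := (p.1 ≤ t → p.2 ≤ t) ∧ (t ≤ p.1 → t ≤ p.2)

theorem integrable_comp_fst {π : Measure (ℝ × ℝ)} {f : ℝ → ℝ} (hf : Integrable f π.fst) :
    Integrable (fun p : ℝ × ℝ => f p.1) π :=
  hf.comp_measurable measurable_fst

theorem integrable_comp_snd {π : Measure (ℝ × ℝ)} {f : ℝ → ℝ} (hf : Integrable f π.snd) :
    Integrable (fun p : ℝ × ℝ => f p.2) π :=
  hf.comp_measurable measurable_snd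

theorem integral_comp_fst {π : Measure (ℝ × ℝ)} {f : ℝ → ℝ} (hf : Integrable f π.fst) :
    ∫ p : ℝ × ℝ, f p.1 ∂π = ∫ x, f x ∂π.fst :=
  (integral_map measurable_fst.aemeasurable hf.aestronglyMeasurable).symm

theorem integral_comp_snd {π : Measure (ℝ × ℝ)} {f : ℝ → ℝ} (hf : Integrable f π.snd) :
    ∫ p : ℝ × ℝ, f p.2 ∂π = ∫ y, f y ∂π.snd :=
  (integral_map measurable_snd.aemeasurable hf.aestronglyMeasurable).symm

/-- Whether a martingale measure crosses the level `t` depends only on its marginals: it does not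
iff `∫ |y - t| dν = ∫ |x - t| dμ`. -/
theorem ae_noCrossing_of_marginals {π π' : Measure (ℝ × ℝ)} [IsFiniteMeasure π]
    [IsFiniteMeasure π'] (hπ : IsMartingaleMeasure π) (hπ' : IsMartingaleMeasure π')
    (hfst : π'.fst = π.fst) (hsnd : π'.snd = π.snd) (hx : Integrable (fun x : ℝ => x) π.fst)
    (hy : Integrable (fun y : ℝ => y) π.snd) {t : ℝ} (h : ∀ᵐ p ∂π, NoCrossing t p) :
    ∀ᵐ p ∂π', NoCrossing t p := by
  set σ : ℝ → ℝ := fun x => if x < t then -1 else if t < x then 1 else 0 with hσdef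
  have hσ : Measurable σ := Measurable.ite measurableSet_Iio measurable_const
    (Measurable.ite measurableSet_Ioi measurable_const measurable_const)
  have hσ1 : ∀ x, |σ x| ≤ 1 := fun x => by simp only [hσdef]; split_ifs <;> simp
  have hσabs : ∀ x, σ x * (x - t) = |x - t| := fun x => by
    simp only [hσdef]
    split_ifs with h1 h2
    · rw [abs_of_neg (by linarith)]; ring
    · rw [abs_of_pos (by linarith)]; ring
    · rw [le_antisymm (not_lt.mp h2) (not_lt.mp h1)]; simp
  set w : ℝ × ℝ → ℝ := fun p => |p.2 - t| - σ p.1 * (p.2 - t) with hw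
  have hw0 : ∀ p, 0 ≤ w p := fun p => by
    have h1 : σ p.1 * (p.2 - t) ≤ |σ p.1| * |p.2 - t| := by
      rw [← abs_mul]; exact le_abs_self _
    have h2 : |σ p.1| * |p.2 - t| ≤ 1 * |p.2 - t| := by gcongr; exact hσ1 _
    simp only [hw]
    linarith
  have hmarg : ∀ ρ : Measure (ℝ × ℝ), IsFiniteMeasure ρ → IsMartingaleMeasure ρ →
      ρ.fst = π.fst → ρ.snd = π.snd → Integrable w ρ ∧
      ∫ p, w p ∂ρ = ∫ y, |y - t| ∂π.snd - ∫ x, |x - t| ∂π.fst := by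
    intro ρ _ hρ h1 h2
    have hwe : w = fun p => |p.2 - t| - |p.1 - t| - σ p.1 * (p.2 - p.1) := by
      funext p
      simp only [hw, ← hσabs p.1]
      ring
    have i1 : Integrable (fun y => |y - t|) ρ.snd := by
      rw [h2]; exact (hy.sub (integrable_const t)).abs
    have i2 : Integrable (fun y => |y - t|) ρ.fst := by
      rw [h1]; exact (hx.sub (integrable_const t)).abs
    obtain ⟨i3, i4⟩ := hρ.integral_mul_eq_zero hσ hσ1
    refine ⟨?_, ?_⟩
    · rw [hwe]
      exact ((integrable_comp_snd i1).sub (integrable_comp_fst i2)).sub i3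
    · calc ∫ p, w p ∂ρ = ∫ p, (|p.2 - t| - |p.1 - t| - σ p.1 * (p.2 - p.1)) ∂ρ := by rw [hwe]
        _ = ∫ p, (|p.2 - t| - |p.1 - t|) ∂ρ - ∫ p, σ p.1 * (p.2 - p.1) ∂ρ :=
          integral_sub ((integrable_comp_snd i1).sub (integrable_comp_fst i2)) i3
        _ = _ := by
          rw [i4, sub_zero, integral_sub (integrable_comp_snd i1) (integrable_comp_fst i2),
            integral_comp_snd i1, integral_comp_fst i2, h1, h2]
  obtain ⟨-, e1⟩ := hmarg π inferInstance hπ rfl rfl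
  obtain ⟨i2, e2⟩ := hmarg π' inferInstance hπ' hfst hsnd
  have hz : ∫ p, w p ∂π = 0 := by
    refine integral_eq_zero_of_ae ?_
    filter_upwards [h] with p hp
    simp only [hw, hσdef, Pi.zero_apply]
    split_ifs with h1 h2
    · rw [abs_of_nonpos (by linarith [hp.1 h1.le])]; ring
    · rw [abs_of_nonneg (by linarith [hp.2 h2.le])]; ring
    · have : p.2 = t := le_antisymm (hp.1 (not_lt.mp h2)) (hp.2 (not_lt.mp h1))
      simp [this]
  rw [e1, ← e2, integral_eq_zero_iff_of_nonneg hw0 i2] at hz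
  filter_upwards [hz] with p hp
  simp only [hw, hσdef, Pi.zero_apply] at hp
  constructor
  · intro h1
    split_ifs at hp with h2 h3
    · have := abs_nonneg (p.2 - t); linarith
    · exact absurd h1 (not_le.mpr h3)
    · have := abs_nonneg (p.2 - t); have := le_abs_self (p.2 - t); linarith
  · intro h1
    split_ifs at hp with h2 h3
    · exact absurd h1 (not_le.mpr h2)
    · have := abs_nonneg (p.2 - t); linarith
    · have := neg_abs_le (p.2 - t); linarith

/-- Countably many levels of a closed set `F` suffice to detect crossings of all levels in `F`. -/
theorem ae_forall_noCrossing {π : Measure (ℝ × ℝ)} {F : Set ℝ} (hF : IsClosed F)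
    (h : ∀ t ∈ F, ∀ᵐ p ∂π, NoCrossing t p) : ∀ᵐ p ∂π, ∀ t ∈ F, NoCrossing t p := by
  have h1 : ∀ᵐ p ∂π, ∀ q : ℚ, (F ∩ Set.Iic (q : ℝ)).Nonempty →
      NoCrossing (sSup (F ∩ Set.Iic (q : ℝ))) p := by
    rw [ae_all_iff]
    intro q
    by_cases hq : (F ∩ Set.Iic (q : ℝ)).Nonempty
    · filter_upwards [h _ ((hF.inter isClosed_Iic).csSup_mem hq ⟨q, fun x hx => hx.2⟩).1]
        with p hp _ using hp
    · exact Filter.Eventually.of_forall fun p hq' => absurd hq' hq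
  have h2 : ∀ᵐ p ∂π, ∀ q : ℚ, (F ∩ Set.Ici (q : ℝ)).Nonempty →
      NoCrossing (sInf (F ∩ Set.Ici (q : ℝ))) p := by
    rw [ae_all_iff]
    intro q
    by_cases hq : (F ∩ Set.Ici (q : ℝ)).Nonempty
    · filter_upwards [h _ ((hF.inter isClosed_Ici).csInf_mem hq ⟨q, fun x hx => hx.2⟩).1]
        with p hp _ using hp
    · exact Filter.Eventually.of_forall fun p hq' => absurd hq' hq
  filter_upwards [h1, h2] with p hp1 hp2 t ht
  constructor
  · intro hxt
    by_contra hty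
    obtain ⟨q, hq1, hq2⟩ := exists_rat_btwn (not_le.mp hty)
    have hmem : t ∈ F ∩ Set.Iic (q : ℝ) := ⟨ht, hq1.le⟩
    have hle : t ≤ sSup (F ∩ Set.Iic (q : ℝ)) := le_csSup ⟨q, fun x hx => hx.2⟩ hmem
    have hge : sSup (F ∩ Set.Iic (q : ℝ)) ≤ q := csSup_le ⟨t, hmem⟩ fun x hx => hx.2
    have := (hp1 q ⟨t, hmem⟩).1 (hxt.trans hle)
    linarith
  · intro hxt
    by_contra hty
    obtain ⟨q, hq1, hq2⟩ := exists_rat_btwn (not_le.mp hty)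
    have hmem : t ∈ F ∩ Set.Ici (q : ℝ) := ⟨ht, hq2.le⟩
    have hle : sInf (F ∩ Set.Ici (q : ℝ)) ≤ t := csInf_le ⟨q, fun x hx => hx.2⟩ hmem
    have hge : q ≤ sInf (F ∩ Set.Ici (q : ℝ)) := le_csInf ⟨t, hmem⟩ fun x hx => hx.2
    have := (hp2 q ⟨t, hmem⟩).2 (hle.trans hxt)
    linarith

/-- If mass enters `Lᶜ` from `L` only at the point `b`, and never enters `L` from outside, then
the second marginal of the mass starting in `L` is determined by the marginals. -/
theorem measure_prod_eq_of_marginals {π π' : Measure (ℝ × ℝ)} [IsFiniteMeasure π]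
    [IsFiniteMeasure π'] (hfst : π'.fst = π.fst) (hsnd : π'.snd = π.snd) {L : Set ℝ}
    (hL : MeasurableSet L) (b : ℝ)
    (h : ∀ᵐ p ∂π, (p.1 ∈ L → p.2 ∈ L ∨ p.2 = b) ∧ (p.1 ∉ L → p.2 ∉ L))
    (h' : ∀ᵐ p ∂π', (p.1 ∈ L → p.2 ∈ L ∨ p.2 = b) ∧ (p.1 ∉ L → p.2 ∉ L)) {E : Set ℝ}
    (hE : MeasurableSet E) : π' (L ×ˢ E) = π (L ×ˢ E) := by
  have key : ∀ ρ : Measure (ℝ × ℝ), IsFiniteMeasure ρ →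
      (∀ᵐ p ∂ρ, (p.1 ∈ L → p.2 ∈ L ∨ p.2 = b) ∧ (p.1 ∉ L → p.2 ∉ L)) →
      ρ (L ×ˢ E) = ρ.snd (E ∩ L) + E.indicator (fun _ => ρ.fst L - ρ.snd L) b := by
    intro ρ _ hρ
    have hin : ∀ D, MeasurableSet D → D ⊆ L → ρ (L ×ˢ D) = ρ.snd D := by
      intro D hD hDL
      rw [Measure.snd_apply hD]
      refine measure_congr ?_
      filter_upwards [hρ] with p hp
      refine propext ⟨fun h => h.2, fun h => ⟨?_, h⟩⟩
      by_contra hpL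
      exact hp.2 hpL (hDL h)
    have hout : ρ (L ×ˢ (E \ L)) = E.indicator (fun _ => ρ.fst L - ρ.snd L) b := by
      by_cases hb : b ∈ E
      · have hsum : ρ.fst L = ρ.snd L + ρ (L ×ˢ (E \ L)) := by
          rw [← hin L hL subset_rfl, Measure.fst_apply hL,
            ← measure_union (Set.disjoint_left.mpr fun p hp hp' => hp'.2.2 hp.2)
              (hL.prod (hE.diff hL))]
          refine measure_congr ?_
          filter_upwards [hρ] with p hp
          refine propext ⟨fun h => ?_, fun h => h.elim (fun h => h.1) (fun h => h.1)⟩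
          by_cases hpL : p.2 ∈ L
          · exact Or.inl ⟨h, hpL⟩
          · exact Or.inr ⟨h, ((hp.1 h).resolve_left hpL) ▸ hb, hpL⟩
        rw [Set.indicator_of_mem hb, hsum, ENNReal.add_sub_cancel_left (measure_ne_top _ _)]
      · rw [Set.indicator_of_notMem hb]
        refine measure_mono_null ?_ (ae_iff.mp hρ)
        rintro p ⟨hp1, hp2, hp3⟩ hp
        exact hb (((hp.1 hp1).resolve_left hp3) ▸ hp2)
    rw [← hin _ (hE.inter hL) Set.inter_subset_right, ← hout,
      ← measure_union (Set.disjoint_left.mpr fun p hp hp' => hp'.2.2 hp.2.2)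
        (hL.prod (hE.diff hL)), ← Set.prod_union, Set.inter_union_sdiff]
  rw [key π inferInstance h, key π' inferInstance h', hfst, hsnd]

/-- The connected component of `q` in the complement of a closed set `F` of the line, as the
intersection of two open half-lines (or `ℝ`) with boundary in `F`. -/
theorem ordConnectedComponent_compl_eq {F : Set ℝ} (hF : IsClosed F) {q : ℝ} (hq : q ∉ F) :
    ∃ L H : Set ℝ, (L = Set.univ ∨ ∃ b ∈ F, q < b ∧ L = Set.Iio b) ∧
      (H = Set.univ ∨ ∃ a ∈ F, a < q ∧ H = Set.Ioi a) ∧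
      Set.ordConnectedComponent Fᶜ q = L ∩ H := by
  have hL : ∃ L : Set ℝ, (L = Set.univ ∨ ∃ b ∈ F, q < b ∧ L = Set.Iio b) ∧
      ∀ x, x ∈ L ↔ ∀ t ∈ F, q < t → x < t := by
    by_cases hne : (F ∩ Set.Ici q).Nonempty
    · have hmem := (hF.inter isClosed_Ici).csInf_mem hne ⟨q, fun x hx => hx.2⟩
      set b := sInf (F ∩ Set.Ici q)
      have hqb : q < b := lt_of_le_of_ne hmem.2 fun h => hq (h ▸ hmem.1)
      exact ⟨Set.Iio b, Or.inr ⟨b, hmem.1, hqb, rfl⟩, fun x => ⟨fun hx t ht hqt =>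
        lt_of_lt_of_le hx (csInf_le (s := F ∩ Set.Ici q) ⟨q, fun x hx => hx.2⟩ ⟨ht, hqt.le⟩),
        fun hx => hx b hmem.1 hqb⟩⟩
    · exact ⟨Set.univ, Or.inl rfl, fun x => ⟨fun _ t ht hqt => (hne ⟨t, ht, hqt.le⟩).elim,
        fun _ => trivial⟩⟩
  have hH : ∃ H : Set ℝ, (H = Set.univ ∨ ∃ a ∈ F, a < q ∧ H = Set.Ioi a) ∧
      ∀ x, x ∈ H ↔ ∀ t ∈ F, t < q → t < x := by
    by_cases hne : (F ∩ Set.Iic q).Nonempty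
    · have hmem := (hF.inter isClosed_Iic).csSup_mem hne ⟨q, fun x hx => hx.2⟩
      set a := sSup (F ∩ Set.Iic q)
      have hqa : a < q := lt_of_le_of_ne hmem.2 fun h => hq (h ▸ hmem.1)
      exact ⟨Set.Ioi a, Or.inr ⟨a, hmem.1, hqa, rfl⟩, fun x => ⟨fun hx t ht hqt =>
        lt_of_le_of_lt (le_csSup (s := F ∩ Set.Iic q) ⟨q, fun x hx => hx.2⟩ ⟨ht, hqt.le⟩) hx,
        fun hx => hx a hmem.1 hqa⟩⟩
    · exact ⟨Set.univ, Or.inl rfl, fun x => ⟨fun _ t ht hqt => (hne ⟨t, ht, hqt.le⟩).elim,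
        fun _ => trivial⟩⟩
  obtain ⟨L, hL, hL'⟩ := hL
  obtain ⟨H, hH, hH'⟩ := hH
  refine ⟨L, H, hL, hH, ?_⟩
  ext x
  rw [Set.mem_ordConnectedComponent, Set.mem_inter_iff, hL', hH']
  constructor
  · intro h
    refine ⟨fun t ht hqt => ?_, fun t ht hqt => ?_⟩
    · by_contra hx
      exact h (Set.mem_uIcc.mpr (Or.inl ⟨hqt.le, not_lt.mp hx⟩)) ht
    · by_contra hx
      exact h (Set.mem_uIcc.mpr (Or.inr ⟨not_lt.mp hx, hqt.le⟩)) ht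
  · rintro ⟨h1, h2⟩ t ht htF
    have htq : t ≠ q := fun h => hq (h ▸ htF)
    rcases Set.mem_uIcc.mp ht with ⟨ha, hb⟩ | ⟨ha, hb⟩
    · exact absurd (h1 t htF (lt_of_le_of_ne ha htq.symm)) (not_lt.mpr hb)
    · exact absurd (h2 t htF (lt_of_le_of_ne hb htq)) (not_lt.mpr ha)

theorem isOpen_ordConnectedComponent_compl {F : Set ℝ} (hF : IsClosed F) {q : ℝ} (hq : q ∉ F) :
    IsOpen (Set.ordConnectedComponent Fᶜ q) := by
  obtain ⟨L, H, hL, hH, h⟩ := ordConnectedComponent_compl_eq hF hq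
  rw [h]
  refine IsOpen.inter ?_ ?_
  · rcases hL with rfl | ⟨b, -, -, rfl⟩
    exacts [isOpen_univ, isOpen_Iio]
  · rcases hH with rfl | ⟨b, -, -, rfl⟩
    exacts [isOpen_univ, isOpen_Ioi]

/-- If no level of the closed set `F` is crossed, then the second marginal of the mass starting in a
component of the complement of `F` is determined by the marginals. -/
theorem snd_restrict_component_eq {π π' : Measure (ℝ × ℝ)} [IsFiniteMeasure π]
    [IsFiniteMeasure π'] (hfst : π'.fst = π.fst) (hsnd : π'.snd = π.snd) {F : Set ℝ}
    (hF : IsClosed F) (h : ∀ᵐ p ∂π, ∀ t ∈ F, NoCrossing t p)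
    (h' : ∀ᵐ p ∂π', ∀ t ∈ F, NoCrossing t p) {q : ℝ} (hq : q ∉ F) :
    (π'.restrict (Set.ordConnectedComponent Fᶜ q ×ˢ Set.univ)).snd =
      (π.restrict (Set.ordConnectedComponent Fᶜ q ×ˢ Set.univ)).snd := by
  obtain ⟨L, H, hL, hH, hI⟩ := ordConnectedComponent_compl_eq hF hq
  rw [hI]
  have hLm : MeasurableSet L := by
    rcases hL with rfl | ⟨b, -, -, rfl⟩
    exacts [MeasurableSet.univ, measurableSet_Iio]
  have hHm : MeasurableSet H := by
    rcases hH with rfl | ⟨b, -, -, rfl⟩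
    exacts [MeasurableSet.univ, measurableSet_Ioi]
  have hLH : L ∪ H = Set.univ := by
    rcases hL with rfl | ⟨b, -, hb, rfl⟩
    · simp
    rcases hH with rfl | ⟨a, -, ha, rfl⟩
    · simp
    exact Set.eq_univ_of_forall fun x => (lt_or_ge x b).imp id fun hx => (ha.trans hb).trans_le hx
  have hL' : ∃ b : ℝ, ∀ p : ℝ × ℝ, (∀ t ∈ F, NoCrossing t p) →
      (p.1 ∈ L → p.2 ∈ L ∨ p.2 = b) ∧ (p.1 ∉ L → p.2 ∉ L) := by
    rcases hL with rfl | ⟨b, hb, -, rfl⟩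
    · exact ⟨0, fun p _ => by simp⟩
    · refine ⟨b, fun p hp => ⟨fun hx => ((hp b hb).1 (le_of_lt hx)).lt_or_eq, fun hx => ?_⟩⟩
      exact not_lt.mpr ((hp b hb).2 (not_lt.mp hx))
  have hH' : ∃ b : ℝ, ∀ p : ℝ × ℝ, (∀ t ∈ F, NoCrossing t p) →
      (p.1 ∈ H → p.2 ∈ H ∨ p.2 = b) ∧ (p.1 ∉ H → p.2 ∉ H) := by
    rcases hH with rfl | ⟨b, hb, -, rfl⟩
    · exact ⟨0, fun p _ => by simp⟩
    · refine ⟨b, fun p hp => ⟨fun hx => ?_, fun hx => ?_⟩⟩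
      · exact ((hp b hb).2 (le_of_lt hx)).lt_or_eq.imp id Eq.symm
      · exact not_lt.mpr ((hp b hb).1 (not_lt.mp hx))
  obtain ⟨b, hb⟩ := hL'
  obtain ⟨a, ha⟩ := hH'
  ext E hE
  have e1 := measure_prod_eq_of_marginals hfst hsnd hLm b (h.mono hb) (h'.mono hb) hE
  have e2 := measure_prod_eq_of_marginals hfst hsnd hHm a (h.mono ha) (h'.mono ha) hE
  have hcount : ∀ ρ : Measure (ℝ × ℝ),
      (ρ.restrict ((L ∩ H) ×ˢ Set.univ)).snd E + ρ.snd E = ρ (L ×ˢ E) + ρ (H ×ˢ E) := by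
    intro ρ
    rw [← measure_union_add_inter _ (hHm.prod hE), ← Set.union_prod, hLH, Measure.snd_apply hE,
      Measure.snd_apply hE, Measure.restrict_apply (measurable_snd hE), add_comm]
    congr 2
    · ext p; simp
    · ext p; simp only [Set.mem_inter_iff, Set.mem_preimage, Set.mem_prod, Set.mem_univ]; tauto
  have := hcount π
  rw [← e1, ← e2, ← hcount π', hsnd] at this
  exact ((ENNReal.add_left_inj (measure_ne_top _ _)).mp this).symm

/-! ### Jensen gaps of convex functions -/

/-- The line through `(z, f z)` with slope `s z`, evaluated at `y`. -/
def tangentLine (f s : ℝ → ℝ) (z y : ℝ) : ℝ := f z + s z * (y - z)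

/-- The projection of the line onto `[a, b]`. -/
def clamp (a b y : ℝ) : ℝ := max a (min b y)

theorem clamp_mem {a b : ℝ} (hab : a ≤ b) (y : ℝ) : clamp a b y ∈ Set.Icc a b :=
  ⟨le_max_left _ _, max_le hab (min_le_left _ _)⟩

theorem clamp_of_mem {a b y : ℝ} (hy : y ∈ Set.Icc a b) : clamp a b y = y := by
  rw [clamp, min_eq_right hy.2, max_eq_right hy.1]

theorem clamp_of_ge {a b y : ℝ} (hab : a ≤ b) (hy : b ≤ y) : clamp a b y = b := by
  rw [clamp, min_eq_left hy, max_eq_right hab]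

theorem clamp_of_le {a b y : ℝ} (hy : y ≤ a) : clamp a b y = a := by
  rw [clamp, max_eq_left ((min_le_right _ _).trans hy)]

theorem monotone_clamp (a b : ℝ) : Monotone (clamp a b) := fun _ _ h =>
  max_le_max le_rfl (min_le_min le_rfl h)

section tangent

variable {f s : ℝ → ℝ}

/-- A selection of subgradients is monotone. -/
theorem slope_le_slope {z z' : ℝ} (h : tangentLine f s z z' ≤ f z')
    (h' : tangentLine f s z' z ≤ f z) (hz : z ≤ z') : s z ≤ s z' := by
  rcases hz.eq_or_lt with rfl | hlt
  · exact le_rfl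
  · simp only [tangentLine] at h h'
    by_contra hs
    nlinarith [not_le.mp hs]

variable {a b : ℝ}

/-- Among the tangents at points of `[a, b]` the one at `clamp a b y` is the highest at `y`. -/
theorem tangentLine_le_clamp (hab : a ≤ b)
    (hT : ∀ z ∈ Set.Icc a b, ∀ z' ∈ Set.Icc a b, tangentLine f s z z' ≤ f z') {z : ℝ}
    (hz : z ∈ Set.Icc a b) (y : ℝ) :
    tangentLine f s z y ≤ tangentLine f s (clamp a b y) y := by
  have ha : a ∈ Set.Icc a b := ⟨le_rfl, hab⟩
  have hb : b ∈ Set.Icc a b := ⟨hab, le_rfl⟩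
  rcases le_total y a with hya | hya
  · rw [clamp_of_le hya]
    have h1 := slope_le_slope (hT a ha z hz) (hT z hz a ha) hz.1
    have h2 := hT z hz a ha
    simp only [tangentLine] at h2 ⊢
    nlinarith
  rcases le_total b y with hyb | hyb
  · rw [clamp_of_ge hab hyb]
    have h1 := slope_le_slope (hT z hz b hb) (hT b hb z hz) hz.2
    have h2 := hT z hz b hb
    simp only [tangentLine] at h2 ⊢
    nlinarith
  · rw [clamp_of_mem ⟨hya, hyb⟩]
    refine (hT z hz y ⟨hya, hyb⟩).trans_eq ?_
    simp [tangentLine]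

/-- Replacing `f` outside `[a, b]` by its tangents at `a` and `b` lowers the gap between `f` and its
tangents. -/
theorem tangent_gap_le (hab : a ≤ b) {x y : ℝ}
    (hT : ∀ z, z = x ∨ z ∈ Set.Icc a b → ∀ z', z' = x ∨ z' = y ∨ z' ∈ Set.Icc a b →
      tangentLine f s z z' ≤ f z') :
    tangentLine f s (clamp a b y) y - tangentLine f s (clamp a b x) y ≤
      f y - tangentLine f s x y := by
  have ha : a ∈ Set.Icc a b := ⟨le_rfl, hab⟩
  have hb : b ∈ Set.Icc a b := ⟨hab, le_rfl⟩
  have hy := hT _ (Or.inr (clamp_mem hab y)) y (Or.inr (Or.inl rfl))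
  have hxy := hT x (Or.inl rfl) y (Or.inr (Or.inl rfl))
  rcases le_total x a with hxa | hxa
  · rw [clamp_of_le hxa]
    rcases le_total y a with hya | hya
    · rw [clamp_of_le hya]; linarith
    · have h1 := slope_le_slope (hT x (Or.inl rfl) a (Or.inr (Or.inr ha)))
        (hT a (Or.inr ha) x (Or.inl rfl)) hxa
      have h2 := hT x (Or.inl rfl) a (Or.inr (Or.inr ha))
      have h3 : tangentLine f s x y ≤ tangentLine f s a y := by
        simp only [tangentLine] at h2 ⊢
        nlinarith
      linarith
  rcases le_total b x with hxb | hxb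
  · rw [clamp_of_ge hab hxb]
    rcases le_total b y with hyb | hyb
    · rw [clamp_of_ge hab hyb]; linarith
    · have h1 := slope_le_slope (hT b (Or.inr hb) x (Or.inl rfl))
        (hT x (Or.inl rfl) b (Or.inr (Or.inr hb))) hxb
      have h2 := hT x (Or.inl rfl) b (Or.inr (Or.inr hb))
      have h3 : tangentLine f s x y ≤ tangentLine f s b y := by
        simp only [tangentLine] at h2 ⊢
        nlinarith
      linarith
  · rw [clamp_of_mem ⟨hxa, hxb⟩]
    linarith

/-- The integral of the truncated gap is determined by the marginals. -/
theorem lintegral_clamp_gap (hab : a ≤ b)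
    (hT : ∀ z ∈ Set.Icc a b, ∀ z' ∈ Set.Icc a b, tangentLine f s z z' ≤ f z') :
    Continuous (fun y => tangentLine f s (clamp a b y) y) ∧
    Measurable (fun p : ℝ × ℝ => tangentLine f s (clamp a b p.2) p.2 -
      tangentLine f s (clamp a b p.1) p.2) ∧
    ∀ π : Measure (ℝ × ℝ), IsFiniteMeasure π → IsMartingaleMeasure π →
      Integrable (fun x : ℝ => x) π.fst → Integrable (fun y : ℝ => y) π.snd →
      ∫⁻ p, ENNReal.ofReal (tangentLine f s (clamp a b p.2) p.2 -
        tangentLine f s (clamp a b p.1) p.2) ∂π =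
      ENNReal.ofReal (∫ y, tangentLine f s (clamp a b y) y ∂π.snd -
        ∫ x, tangentLine f s (clamp a b x) x ∂π.fst) := by
  set g : ℝ → ℝ := fun y => tangentLine f s (clamp a b y) y with hg
  set σ : ℝ → ℝ := fun y => s (clamp a b y) with hσdef
  have hlin : ∀ x y, tangentLine f s (clamp a b x) y = g x + σ x * (y - x) := fun x y => by
    simp only [hg, hσdef, tangentLine]; ring
  have hgσ : ∀ x y, g x + σ x * (y - x) ≤ g y := fun x y => by
    rw [← hlin]; exact tangentLine_le_clamp hab hT (clamp_mem hab x) y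
  have hσmono : Monotone σ := fun x y hxy =>
    show s (clamp a b x) ≤ s (clamp a b y) from
      slope_le_slope (hT _ (clamp_mem hab x) _ (clamp_mem hab y))
        (hT _ (clamp_mem hab y) _ (clamp_mem hab x)) (monotone_clamp a b hxy)
  set C := max |s a| |s b| with hC
  have hσC : ∀ x, |σ x| ≤ C := fun x => by
    have h1 : s a ≤ σ x := by
      have := hσmono (min_le_left x a)
      simp only [hσdef, clamp_of_le (min_le_right x a)] at this
      exact this
    have h2 : σ x ≤ s b := by
      have := hσmono (le_max_left x b)
      simp only [hσdef, clamp_of_ge hab (le_max_right x b)] at this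
      exact this
    exact abs_le_max_abs_abs h1 h2
  have hlip : ∀ x y, |g x - g y| ≤ C * |x - y| := by
    have h1 : ∀ x y, g x - g y ≤ C * |x - y| := fun x y => by
      have h1 := hgσ x y
      have h2 : σ x * (x - y) ≤ |σ x| * |x - y| := by rw [← abs_mul]; exact le_abs_self _
      have h3 : |σ x| * |x - y| ≤ C * |x - y| := by gcongr; exact hσC x
      linarith
    intro x y
    refine abs_le.mpr ⟨?_, h1 x y⟩
    have := h1 y x
    rw [abs_sub_comm] at this
    linarith
  have hcont : Continuous g := by
    refine (LipschitzWith.of_dist_le_mul (K := ⟨C, (abs_nonneg _).trans (le_max_left _ _)⟩)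
      fun x y => ?_).continuous
    rw [Real.dist_eq, Real.dist_eq]
    exact hlip x y
  refine ⟨hcont, ?_, ?_⟩
  · simp only [hlin]
    have := hσmono.measurable
    have := hcont.measurable
    fun_prop
  · intro π _ hπ hx hy
    have hgint : ∀ ρ : Measure ℝ, IsFiniteMeasure ρ → Integrable (fun x : ℝ => x) ρ →
        Integrable g ρ := by
      intro ρ _ hρ
      refine Integrable.mono' ((hρ.abs.const_mul C).add (integrable_const |g 0|))
        hcont.aestronglyMeasurable (Filter.Eventually.of_forall fun x => ?_)
      have h1 := hlip x 0
      have h2 := abs_sub_abs_le_abs_sub (g x) (g 0)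
      rw [sub_zero] at h1
      simp only [Real.norm_eq_abs, Pi.add_apply]
      linarith
    have i1 := hgint π.snd inferInstance hy
    have i2 := hgint π.fst inferInstance hx
    obtain ⟨i3, i4⟩ := hπ.integral_mul_eq_zero hσmono.measurable hσC
    have hd : ∀ p : ℝ × ℝ, tangentLine f s (clamp a b p.2) p.2 -
        tangentLine f s (clamp a b p.1) p.2 = g p.2 - g p.1 - σ p.1 * (p.2 - p.1) := fun p => by
      rw [hlin, hlin]; ring
    simp only [hd]
    have i5 : Integrable (fun p : ℝ × ℝ => g p.2 - g p.1 - σ p.1 * (p.2 - p.1)) π :=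
      ((integrable_comp_snd i1).sub (integrable_comp_fst i2)).sub i3
    rw [← ofReal_integral_eq_lintegral_ofReal i5 (Filter.Eventually.of_forall fun p => by
      have := hgσ p.1 p.2
      simp only [Pi.zero_apply]
      linarith)]
    congr 1
    calc ∫ p : ℝ × ℝ, (g p.2 - g p.1 - σ p.1 * (p.2 - p.1)) ∂π
        = ∫ p : ℝ × ℝ, (g p.2 - g p.1) ∂π - ∫ p : ℝ × ℝ, σ p.1 * (p.2 - p.1) ∂π :=
          integral_sub ((integrable_comp_snd i1).sub (integrable_comp_fst i2)) i3
      _ = _ := by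
          rw [i4, sub_zero, integral_sub (integrable_comp_snd i1) (integrable_comp_fst i2),
            integral_comp_snd i1, integral_comp_fst i2]

end tangent

theorem exists_exhaustion_Icc {I : Set ℝ} (hI : IsOpen I) (hne : I.Nonempty) :
    ∃ a b : ℕ → ℝ, (∀ n, a n ≤ b n ∧ a n ∈ I ∧ b n ∈ I) ∧
      ∀ w ∈ I, ∀ᶠ n in Filter.atTop, w ∈ Set.Icc (a n) (b n) := by
  have hne' : {r : ℚ | (r : ℝ) ∈ I}.Nonempty := by
    obtain ⟨r, hr⟩ := Rat.denseRange_cast.exists_mem_open hI hne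
    exact ⟨r, hr⟩
  obtain ⟨e, he⟩ := (Set.to_countable {r : ℚ | (r : ℝ) ∈ I}).exists_eq_range hne'
  have heI : ∀ n, (e n : ℝ) ∈ I := fun n => by
    have : e n ∈ {r : ℚ | (r : ℝ) ∈ I} := he ▸ ⟨n, rfl⟩
    exact this
  have hR : ∀ n : ℕ, (Finset.range (n + 1)).Nonempty := fun n => ⟨0, by simp⟩
  refine ⟨fun n => (Finset.range (n + 1)).inf' (hR n) fun i => (e i : ℝ),
    fun n => (Finset.range (n + 1)).sup' (hR n) fun i => (e i : ℝ), fun n => ⟨?_, ?_, ?_⟩, ?_⟩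
  · exact (Finset.inf'_le (b := 0) _ (by simp)).trans
      (Finset.le_sup' (b := 0) (fun i => (e i : ℝ)) (by simp))
  · obtain ⟨i, -, hi⟩ := Finset.exists_mem_eq_inf' (hR n) fun i => (e i : ℝ)
    beta_reduce; rw [hi]; exact heI i
  · obtain ⟨i, -, hi⟩ := Finset.exists_mem_eq_sup' (hR n) fun i => (e i : ℝ)
    beta_reduce; rw [hi]; exact heI i
  · intro w hw
    obtain ⟨l, u, ⟨hlw, hwu⟩, hlu⟩ := mem_nhds_iff_exists_Ioo_subset.mp (hI.mem_nhds hw)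
    obtain ⟨r, hr1, hr2⟩ := exists_rat_btwn hlw
    obtain ⟨r', hr1', hr2'⟩ := exists_rat_btwn hwu
    have hr : r ∈ Set.range e := he ▸ (show (r : ℝ) ∈ I from hlu ⟨hr1, hr2.trans hwu⟩)
    have hr' : r' ∈ Set.range e := he ▸ (show (r' : ℝ) ∈ I from hlu ⟨hlw.trans hr1', hr2'⟩)
    obtain ⟨i, rfl⟩ := hr
    obtain ⟨j, rfl⟩ := hr'
    filter_upwards [Filter.eventually_ge_atTop i, Filter.eventually_ge_atTop j] with n hi hj
    exact ⟨(Finset.inf'_le (fun i => (e i : ℝ)) (Finset.mem_range.mpr (by omega))).trans hr2.le,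
      hr1'.le.trans (Finset.le_sup' (fun i => (e i : ℝ)) (Finset.mem_range.mpr (by omega)))⟩

/-- For a convex `f`, given on `K` as a supremum of tangents at points of the open interval `I`, the
integrated Jensen gap `∫ (f y - f x - s x (y - x)) dπ` depends on the martingale measure `π` only
through its marginals, also when `f` is not integrable: it is the limit of the gaps of the functions
that agree with `f` on a compact interval and are affine outside. -/
theorem exists_jensen_gap {f s : ℝ → ℝ} {I K : Set ℝ} (hI : IsOpen I) (hIc : I.OrdConnected)
    (hne : I.Nonempty) (hIK : I ⊆ K) (hT : ∀ z ∈ I, ∀ y ∈ K, tangentLine f s z y ≤ f y)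
    (hsup : ∀ y ∈ K, ∀ ε > 0, ∃ w ∈ I, f y - ε < tangentLine f s w y) :
    (∀ ν : Measure ℝ, (∀ᵐ y ∂ν, y ∈ K) → AEMeasurable f ν) ∧
    ∃ D : ℝ × ℝ → ℝ≥0∞, Measurable D ∧
      (∀ x ∈ I, ∀ y ∈ K, D (x, y) = ENNReal.ofReal (f y - tangentLine f s x y)) ∧
      ∀ π π' : Measure (ℝ × ℝ), IsFiniteMeasure π → IsFiniteMeasure π' →
        IsMartingaleMeasure π → IsMartingaleMeasure π' → π'.fst = π.fst → π'.snd = π.snd →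
        Integrable (fun x : ℝ => x) π.fst → Integrable (fun y : ℝ => y) π.snd →
        (∀ᵐ p ∂π, p.1 ∈ I ∧ p.2 ∈ K) → ∫⁻ p, D p ∂π' ≤ ∫⁻ p, D p ∂π := by
  obtain ⟨a, b, hab, hex⟩ := exists_exhaustion_Icc hI hne
  have hsub : ∀ n, Set.Icc (a n) (b n) ⊆ I := fun n => hIc.out (hab n).2.1 (hab n).2.2
  have hTn : ∀ n, ∀ z ∈ Set.Icc (a n) (b n), ∀ z' ∈ Set.Icc (a n) (b n),
      tangentLine f s z z' ≤ f z' := fun n z hz z' hz' => hT z (hsub n hz) z' (hIK (hsub n hz'))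
  set g : ℕ → ℝ → ℝ := fun n y => tangentLine f s (clamp (a n) (b n) y) y with hg
  have hglim : ∀ y ∈ K, Filter.Tendsto (fun n => g n y) Filter.atTop (nhds (f y)) := by
    intro y hy
    rw [Metric.tendsto_atTop']
    intro ε hε
    obtain ⟨w, hw, hwε⟩ := hsup y hy ε hε
    obtain ⟨N, hN⟩ := Filter.eventually_atTop.mp (hex w hw)
    refine ⟨N, fun n hn => ?_⟩
    have h1 := tangentLine_le_clamp (hab n).1 (hTn n) (hN n hn.le) y
    have h2 := hT _ (hsub n (clamp_mem (hab n).1 y)) y hy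
    rw [Real.dist_eq, abs_lt]
    constructor <;> simp only [hg] <;> linarith
  set d : ℕ → ℝ × ℝ → ℝ≥0∞ := fun n p =>
    ENNReal.ofReal (g n p.2 - tangentLine f s (clamp (a n) (b n) p.1) p.2) with hd
  have hdm : ∀ n, Measurable (d n) := fun n =>
    (lintegral_clamp_gap (hab n).1 (hTn n)).2.1.ennreal_ofReal
  have hdlim : ∀ x ∈ I, ∀ y ∈ K, Filter.Tendsto (fun n => d n (x, y)) Filter.atTop
      (nhds (ENNReal.ofReal (f y - tangentLine f s x y))) := by
    intro x hx y hy
    refine ENNReal.tendsto_ofReal ((hglim y hy).sub (tendsto_const_nhds.congr' ?_))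
    filter_upwards [hex x hx] with n hn
    rw [clamp_of_mem hn]
  refine ⟨fun ν hν => aemeasurable_of_tendsto_metrizable_ae Filter.atTop
    (fun n => (lintegral_clamp_gap (hab n).1 (hTn n)).1.measurable.aemeasurable)
    (hν.mono fun y hy => hglim y hy), fun p => Filter.liminf (fun n => d n p) Filter.atTop,
    Measurable.liminf hdm, fun x hx y hy => (hdlim x hx y hy).liminf_eq, ?_⟩
  intro π π' _ _ hπ hπ' hfst hsnd hx hy hae
  calc ∫⁻ p, Filter.liminf (fun n => d n p) Filter.atTop ∂π'
      ≤ Filter.liminf (fun n => ∫⁻ p, d n p ∂π') Filter.atTop := lintegral_liminf_le hdm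
    _ = Filter.liminf (fun n => ∫⁻ p, d n p ∂π) Filter.atTop := by
        congr 1
        funext n
        have key := (lintegral_clamp_gap (hab n).1 (hTn n)).2.2
        have e1 := key π' inferInstance hπ' (hfst ▸ hx) (hsnd ▸ hy)
        rw [hfst, hsnd] at e1
        exact e1.trans (key π inferInstance hπ hx hy).symm
    _ ≤ ∫⁻ p, Filter.liminf (fun n => d n p) Filter.atTop ∂π := by
        refine Filter.liminf_le_of_le (by isBoundedDefault) fun c hc => ?_
        obtain ⟨n, hn⟩ := hc.exists
        refine hn.trans (lintegral_mono_ae ?_)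
        filter_upwards [hae] with p hp
        rw [(hdlim p.1 hp.1 p.2 hp.2).liminf_eq]
        refine ENNReal.ofReal_le_ofReal (tangent_gap_le (hab n).1 fun z hz z' hz' => hT z ?_ z' ?_)
        · rcases hz with rfl | hz
          exacts [hp.1, hsub n hz]
        · rcases hz' with rfl | rfl | hz'
          exacts [hIK hp.1, hp.2, hIK (hsub n hz')]

/-! ### Measurability of potentials and a convex moderator -/

theorem ae_ae_condKernel {π : Measure (ℝ × ℝ)} [IsFiniteMeasure π] {P : ℝ × ℝ → Prop}
    (h : ∀ᵐ p ∂π, P p) :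
    ∀ᵐ x ∂π.fst, ∀ᵐ y ∂π.condKernel x, P (x, y) := by
  rw [← π.disintegrate π.condKernel] at h
  exact Measure.ae_ae_of_ae_compProd h

theorem ae_fst_of_ae {π : Measure (ℝ × ℝ)} [IsFiniteMeasure π] {P : ℝ → Prop}
    (h : ∀ᵐ p ∂π, P p.1) : ∀ᵐ x ∂π.fst, P x := by
  filter_upwards [ae_ae_condKernel h] with x hx
  exact hx.exists.choose_spec

theorem ae_snd_of_ae {π : Measure (ℝ × ℝ)} [IsFiniteMeasure π] {P : ℝ → Prop}
    (h : ∀ᵐ p ∂π, P p.2) : ∀ᵐ y ∂π.snd, P y := by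
  have h' : ∀ᵐ p ∂π.map Prod.swap, P p.1 :=
    (MeasurableEquiv.prodComm.measurableEmbedding.ae_map_iff).mpr h
  have := ae_fst_of_ae h'
  rwa [Measure.fst_map_swap] at this

theorem ae_of_ae_fst {π : Measure (ℝ × ℝ)} {P : ℝ → Prop}
    (h : ∀ᵐ x ∂π.fst, P x) : ∀ᵐ p ∂π, P p.1 :=
  ae_of_ae_map measurable_fst.aemeasurable h

theorem ae_of_ae_snd {π : Measure (ℝ × ℝ)} {P : ℝ → Prop}
    (h : ∀ᵐ y ∂π.snd, P y) : ∀ᵐ p ∂π, P p.2 :=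
  ae_of_ae_map measurable_snd.aemeasurable h

/-- A multiple of a function of mean zero does not affect the comparison of integrals of nonnegative
functions, even if they are infinite. -/
theorem lintegral_le_of_le_add_mul {α : Type*} [MeasurableSpace α] {κ : Measure α} {w p : α → ℝ}
    {Q : α → ℝ≥0∞} {k : ℝ} (hw : Integrable w κ) (hw0 : ∫ y, w y ∂κ = 0) (hQ : AEMeasurable Q κ)
    (h : ∀ᵐ y ∂κ, Q y ≠ ⊤ ∧ 0 ≤ p y ∧ p y ≤ (Q y).toReal + k * w y) :
    ∫⁻ y, ENNReal.ofReal (p y) ∂κ ≤ ∫⁻ y, Q y ∂κ := by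
  by_cases hfin : ∫⁻ y, Q y ∂κ = ⊤
  · rw [hfin]; exact le_top
  have hint : Integrable (fun y => (Q y).toReal) κ := integrable_toReal_of_lintegral_ne_top hQ hfin
  have hint' : Integrable (fun y => (Q y).toReal + k * w y) κ := hint.add (hw.const_mul k)
  calc ∫⁻ y, ENNReal.ofReal (p y) ∂κ ≤ ∫⁻ y, ENNReal.ofReal ((Q y).toReal + k * w y) ∂κ :=
        lintegral_mono_ae (h.mono fun y hy => ENNReal.ofReal_le_ofReal hy.2.2)
    _ = ENNReal.ofReal (∫ y, ((Q y).toReal + k * w y) ∂κ) :=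
        (ofReal_integral_eq_lintegral_ofReal hint' (h.mono fun y hy => hy.2.1.trans hy.2.2)).symm
    _ = ENNReal.ofReal (∫ y, (Q y).toReal ∂κ) := by
        rw [integral_add hint (hw.const_mul k), integral_const_mul, hw0, mul_zero, add_zero]
    _ = ∫⁻ y, ENNReal.ofReal (Q y).toReal ∂κ :=
        ofReal_integral_eq_lintegral_ofReal hint
          (Filter.Eventually.of_forall fun y => ENNReal.toReal_nonneg)
    _ = ∫⁻ y, Q y ∂κ :=
        lintegral_congr_ae (h.mono fun y hy => ENNReal.ofReal_toReal hy.1)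

/-- Among the potentials, `ψ` is measurable without any choice: on the projection of `G` it is an
infimum of the upper semicontinuous functions `c (x, ·) - φ x - k x * (· - x)`. -/
theorem aemeasurable_potential {c : ℝ × ℝ → ℝ≥0} (hc : UpperSemicontinuous c) {G : Set (ℝ × ℝ)}
    {φ ψ k : ℝ → ℝ}
    (hle : ∀ p ∈ G, ∀ q ∈ G, φ p.1 + ψ q.2 + k p.1 * (q.2 - p.1) ≤ c (p.1, q.2))
    (heq : ∀ p ∈ G, φ p.1 + ψ p.2 + k p.1 * (p.2 - p.1) = c p) {ν : Measure ℝ}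
    (hν : ∀ᵐ y ∂ν, ∃ p ∈ G, p.2 = y) : AEMeasurable ψ ν := by
  obtain ⟨Z, hZsub, hZm, hZ0⟩ := exists_measurable_superset_of_null (ae_iff.mp hν)
  have hZY : ∀ y ∈ Zᶜ, ∃ p ∈ G, p.2 = y := fun y hy => by
    by_contra h
    exact hy (hZsub h)
  refine ⟨Zᶜ.indicator ψ, measurable_of_Iio fun r => ?_, ?_⟩
  · have husc : ∀ x, IsOpen {y | (c (x, y) : ℝ) - φ x - k x * (y - x) < r} := fun x => by
      have h1 : UpperSemicontinuous fun y : ℝ => (c (x, y) : ℝ) :=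
        NNReal.continuous_coe.comp_upperSemicontinuous
          (hc.comp (Continuous.prodMk_right x)) NNReal.coe_mono
      have h2 : Continuous fun y : ℝ => - φ x - k x * (y - x) := by fun_prop
      convert (h1.add h2.upperSemicontinuous).isOpen_preimage r using 1
      ext y
      simp only [Set.mem_preimage, Set.mem_Iio, Set.mem_ofPred_eq]
      rw [← sub_neg, ← sub_neg (b := r)]
      ring_nf
    have : Zᶜ.indicator ψ ⁻¹' Set.Iio r =
        (Zᶜ ∩ ⋃ p ∈ G, {y | (c (p.1, y) : ℝ) - φ p.1 - k p.1 * (y - p.1) < r}) ∪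
          (Z ∩ {_y | 0 < r}) := by
      ext y
      by_cases hy : y ∈ Z
      · simp [hy]
      · simp only [Set.mem_preimage, Set.indicator_of_mem (show y ∈ Zᶜ from hy), Set.mem_Iio,
          Set.mem_union, Set.mem_inter_iff, Set.mem_compl_iff, hy, not_false_eq_true, true_and,
          false_and, or_false, Set.mem_iUnion, Set.mem_ofPred_eq, exists_prop]
        obtain ⟨q, hq, rfl⟩ := hZY y hy
        constructor
        · intro h
          refine ⟨q, hq, ?_⟩
          have := heq q hq
          linarith
        · rintro ⟨p, hp, h⟩
          have := hle p hp q hq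
          linarith
    rw [this]
    exact (hZm.compl.inter (isOpen_biUnion fun p _ => husc p.1).measurableSet).union
      (hZm.inter (MeasurableSet.const _))
  · filter_upwards [measure_eq_zero_iff_ae_notMem.mp hZ0] with y hy
    rw [Set.indicator_of_mem (show y ∈ Zᶜ from hy)]

/-- A supremum of affine functions has supporting lines at the points of an open set on which it is
finite. -/
theorem exists_subgradient {f : ℝ → ℝ} {I K : Set ℝ} (hI : IsOpen I) (hIK : I ⊆ K)
    (hf : ∀ w ∈ K, ∀ z, ∀ y ∈ K, w < z → z < y → (y - w) * f z ≤ (y - z) * f w + (z - w) * f y)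
    {z : ℝ} (hz : z ∈ I) : ∃ σ : ℝ, ∀ y ∈ K, f z + σ * (y - z) ≤ f y := by
  obtain ⟨l, u, ⟨hlz, hzu⟩, hlu⟩ := mem_nhds_iff_exists_Ioo_subset.mp (hI.mem_nhds hz)
  obtain ⟨w₀, hw₀, hw₀z⟩ := exists_between hlz
  obtain ⟨y₀, hy₀z, hy₀⟩ := exists_between hzu
  have hw₀K : w₀ ∈ K := hIK (hlu ⟨hw₀, hw₀z.trans hzu⟩)
  have hy₀K : y₀ ∈ K := hIK (hlu ⟨hlz.trans hy₀z, hy₀⟩)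
  set A : Set ℝ := {r | ∃ w ∈ K, w < z ∧ r = (f z - f w) / (z - w)}
  have hslope : ∀ w ∈ K, w < z → ∀ y ∈ K, z < y →
      (f z - f w) / (z - w) ≤ (f y - f z) / (y - z) := by
    intro w hw hwz y hy hzy
    rw [div_le_div_iff₀ (sub_pos.mpr hwz) (sub_pos.mpr hzy)]
    nlinarith [hf w hw z y hy hwz hzy]
  have hA : A.Nonempty := ⟨_, w₀, hw₀K, hw₀z, rfl⟩
  have hAb : BddAbove A := ⟨(f y₀ - f z) / (y₀ - z), by
    rintro r ⟨w, hw, hwz, rfl⟩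
    exact hslope w hw hwz y₀ hy₀K hy₀z⟩
  refine ⟨sSup A, fun y hy => ?_⟩
  rcases lt_trichotomy y z with h | rfl | h
  · have := le_csSup hAb ⟨y, hy, h, rfl⟩
    rw [div_le_iff₀ (sub_pos.mpr h)] at this
    linarith
  · simp
  · have : sSup A ≤ (f y - f z) / (y - z) := csSup_le hA (by
      rintro r ⟨w, hw, hwz, rfl⟩
      exact hslope w hw hwz y hy h)
    rw [le_div_iff₀ (sub_pos.mpr h)] at this
    linarith

/-- A moderating convex function: if affine functions `ℓ p` satisfy `ℓ p ≤ B` at the points of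
`Y`, their supremum `f` is finite on the open interval `I` spanned by `Y` and at `Y`, and it is the
supremum of its tangents at points of `I`. -/
theorem exists_moderator {ι : Type*} [Nonempty ι] {α β : ι → ℝ} {B : ℝ → ℝ} {I Y : Set ℝ}
    (hI : IsOpen I) (hIc : I.OrdConnected) (hne : I.Nonempty) (hY : Y ⊆ closure I)
    (hIY : ∀ t ∈ I, ∃ y₁ ∈ Y, ∃ y₂ ∈ Y, y₁ < t ∧ t < y₂)
    (hB : ∀ i, ∀ y ∈ Y, α i + β i * y ≤ B y) :
    ∃ (f s : ℝ → ℝ) (K : Set ℝ), I ⊆ K ∧ Y ⊆ K ∧ (∀ i, ∀ y ∈ K, α i + β i * y ≤ f y) ∧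
      (∀ y ∈ Y, f y ≤ B y) ∧ (∀ z ∈ I, ∀ y ∈ K, tangentLine f s z y ≤ f y) ∧
      ∀ y ∈ K, ∀ ε > 0, ∃ w ∈ I, f y - ε < tangentLine f s w y := by
  set f : ℝ → ℝ := fun y => ⨆ i, (α i + β i * y) with hf
  set K : Set ℝ := {y | BddAbove (Set.range fun i => α i + β i * y)} ∩ closure I with hK
  have hbdd : ∀ y ∈ Y, BddAbove (Set.range fun i => α i + β i * y) := fun y hy =>
    ⟨B y, by rintro _ ⟨i, rfl⟩; exact hB i y hy⟩
  have hle : ∀ i, ∀ y ∈ K, α i + β i * y ≤ f y := fun i y hy => le_ciSup hy.1 i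
  have hYK : Y ⊆ K := fun y hy => ⟨hbdd y hy, hY hy⟩
  have hIK : I ⊆ K := by
    intro t ht
    obtain ⟨y₁, hy₁, y₂, hy₂, h1, h2⟩ := hIY t ht
    refine ⟨⟨max (B y₁) (B y₂), ?_⟩, subset_closure ht⟩
    rintro _ ⟨i, rfl⟩
    rcases le_total 0 (β i) with h | h
    · refine le_trans ?_ ((hB i y₂ hy₂).trans (le_max_right _ _))
      nlinarith
    · refine le_trans ?_ ((hB i y₁ hy₁).trans (le_max_left _ _))
      nlinarith
  have hconv : ∀ w ∈ K, ∀ z, ∀ y ∈ K, w < z → z < y →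
      (y - w) * f z ≤ (y - z) * f w + (z - w) * f y := by
    intro w hw z y hy hwz hzy
    have hwy : 0 < y - w := by linarith
    rw [mul_comm, ← le_div_iff₀ hwy]
    refine ciSup_le fun i => ?_
    rw [le_div_iff₀ hwy]
    have h1 := mul_le_mul_of_nonneg_left (hle i w hw) (sub_nonneg.mpr hzy.le)
    have h2 := mul_le_mul_of_nonneg_left (hle i y hy) (sub_nonneg.mpr hwz.le)
    nlinarith
  have hsub : ∀ z, ∃ σ : ℝ, z ∈ I → ∀ y ∈ K, f z + σ * (y - z) ≤ f y := by
    intro z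
    by_cases hz : z ∈ I
    · obtain ⟨σ, hσ⟩ := exists_subgradient hI hIK hconv hz
      exact ⟨σ, fun _ => hσ⟩
    · exact ⟨0, fun h => absurd h hz⟩
  choose s hs using hsub
  refine ⟨f, s, K, hIK, hYK, hle, fun y hy => ciSup_le fun i => hB i y hy, fun z hz => hs z hz, ?_⟩
  intro y hy ε hε
  by_cases hyI : y ∈ I
  · exact ⟨y, hyI, by simp [tangentLine, hε]⟩
  -- `y` is an endpoint of `I`: follow an affine function almost attaining `f y`.
  obtain ⟨w₀, hw₀⟩ := hne
  obtain ⟨i, hi⟩ := exists_lt_of_lt_ciSup (show f y - ε < ⨆ i, (α i + β i * y) by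
    simp only [hf]; linarith)
  have hcont : Filter.Tendsto (fun δ : ℝ => α i + β i * (y + δ * (w₀ - y)) +
      s w₀ * (y - (y + δ * (w₀ - y)))) (nhdsWithin 0 (Set.Ioi 0)) (nhds (α i + β i * y)) := by
    refine tendsto_nhdsWithin_of_tendsto_nhds ?_
    have : Continuous (fun δ : ℝ => α i + β i * (y + δ * (w₀ - y)) +
      s w₀ * (y - (y + δ * (w₀ - y)))) := by fun_prop
    convert this.tendsto 0 using 2
    ring
  obtain ⟨δ, hδ, hδ0, hδ1⟩ := ((hcont.eventually_const_lt hi).and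
    (Ioo_mem_nhdsGT (zero_lt_one' ℝ))).exists
  set w := y + δ * (w₀ - y) with hw
  have hwI : w ∈ I := by
    have := hIc.convex.openSegment_closure_interior_subset_interior (𝕜 := ℝ) hy.2
      (hI.interior_eq.symm ▸ hw₀)
    rw [hI.interior_eq] at this
    exact this ⟨1 - δ, δ, by linarith, hδ0, by ring, by simp only [smul_eq_mul, hw]; ring⟩
  refine ⟨w, hwI, hδ.trans_le ?_⟩
  have h1 := hle i w (hIK hwI)
  have h2 : s w₀ * (y - w) ≤ s w * (y - w) := by
    rcases le_total w₀ y with h | h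
    · refine mul_le_mul_of_nonneg_right (slope_le_slope (f := f) (hs w₀ hw₀ w (hIK hwI))
        (hs w hwI w₀ (hIK hw₀)) ?_) ?_ <;> nlinarith
    · refine mul_le_mul_of_nonpos_right (slope_le_slope (f := f) (hs w hwI w₀ (hIK hw₀))
        (hs w₀ hw₀ w (hIK hwI)) ?_) ?_ <;> nlinarith
  simp only [tangentLine]
  linarith

/-! ### Optimality on one component -/

/-- If `g ≤ u ⊕ Q` up to a martingale increment `m x * (y - x)`, then `∫ g dπ ≤ ∫ u dμ + ∫ Q dπ`,
whatever the measurability of `u` and `m`. -/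
theorem lintegral_le_lintegral_fst_add {π : Measure (ℝ × ℝ)} [IsFiniteMeasure π]
    (hπ : IsMartingaleMeasure π) {g : ℝ × ℝ → ℝ} {u m : ℝ → ℝ} {Q : ℝ × ℝ → ℝ≥0∞}
    (hg : Measurable g) (hQ : Measurable Q)
    (h : ∀ᵐ p ∂π, Q p ≠ ⊤ ∧ 0 ≤ g p ∧ 0 ≤ u p.1 ∧
      g p ≤ u p.1 + (Q p).toReal + m p.1 * (p.2 - p.1)) :
    ∫⁻ p, ENNReal.ofReal (g p) ∂π ≤ ∫⁻ x, ENNReal.ofReal (u x) ∂π.fst + ∫⁻ p, Q p ∂π := by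
  have hsec : ∀ᵐ x ∂π.fst, ∫⁻ y, ENNReal.ofReal (g (x, y)) ∂π.condKernel x ≤
      ENNReal.ofReal (u x) + ∫⁻ y, Q (x, y) ∂π.condKernel x := by
    filter_upwards [ae_ae_condKernel h, hπ.ae_integral_condKernel,
      hπ.integrable_sub.condKernel_ae] with x hx hmean hint
    have hQx : Measurable fun y => Q (x, y) := hQ.comp measurable_prodMk_left
    refine (lintegral_le_of_le_add_mul (Q := fun y => ENNReal.ofReal (u x) + Q (x, y))
      (k := m x) hint hmean (by fun_prop) ?_).trans_eq ?_
    · filter_upwards [hx] with y hy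
      refine ⟨ENNReal.add_ne_top.mpr ⟨ENNReal.ofReal_ne_top, hy.1⟩, hy.2.1, ?_⟩
      rw [ENNReal.toReal_add ENNReal.ofReal_ne_top hy.1, ENNReal.toReal_ofReal hy.2.2.1]
      exact hy.2.2.2
    · rw [lintegral_add_left measurable_const, lintegral_const, measure_univ, mul_one]
  rw [← Measure.lintegral_condKernel hg.ennreal_ofReal, ← Measure.lintegral_condKernel hQ,
    ← lintegral_add_right _ hQ.lintegral_kernel_prod_right']
  exact lintegral_mono_ae hsec

/-- The inequality reverse to `lintegral_le_lintegral_fst_add`, for a measure carried by the contact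
set. -/
theorem lintegral_fst_add_le {π : Measure (ℝ × ℝ)} [IsFiniteMeasure π]
    (hπ : IsMartingaleMeasure π) {g : ℝ × ℝ → ℝ} {u m : ℝ → ℝ} {Q : ℝ × ℝ → ℝ≥0∞}
    (hg : Measurable g) (hQ : Measurable Q)
    (h : ∀ᵐ p ∂π, Q p ≠ ⊤ ∧ 0 ≤ g p ∧ 0 ≤ u p.1 ∧
      u p.1 + (Q p).toReal ≤ g p + m p.1 * (p.2 - p.1)) :
    ∫⁻ x, ENNReal.ofReal (u x) ∂π.fst + ∫⁻ p, Q p ∂π ≤ ∫⁻ p, ENNReal.ofReal (g p) ∂π := by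
  have hsec : ∀ᵐ x ∂π.fst, ENNReal.ofReal (u x) + ∫⁻ y, Q (x, y) ∂π.condKernel x ≤
      ∫⁻ y, ENNReal.ofReal (g (x, y)) ∂π.condKernel x := by
    filter_upwards [ae_ae_condKernel h, hπ.ae_integral_condKernel,
      hπ.integrable_sub.condKernel_ae] with x hx hmean hint
    have hgx : Measurable fun y => ENNReal.ofReal (g (x, y)) :=
      (hg.comp measurable_prodMk_left).ennreal_ofReal
    refine le_trans (le_of_eq ?_) (lintegral_le_of_le_add_mul (k := m x)
      (p := fun y => u x + (Q (x, y)).toReal) hint hmean hgx.aemeasurable ?_)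
    · calc ENNReal.ofReal (u x) + ∫⁻ y, Q (x, y) ∂π.condKernel x
          = ∫⁻ y, (ENNReal.ofReal (u x) + Q (x, y)) ∂π.condKernel x := by
            rw [lintegral_add_left measurable_const, lintegral_const, measure_univ, mul_one]
        _ = _ := lintegral_congr_ae (hx.mono fun y hy => by
            beta_reduce
            rw [ENNReal.ofReal_add hy.2.2.1 ENNReal.toReal_nonneg, ENNReal.ofReal_toReal hy.1])
    · filter_upwards [hx] with y hy
      refine ⟨ENNReal.ofReal_ne_top, add_nonneg hy.2.2.1 ENNReal.toReal_nonneg, ?_⟩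
      rw [ENNReal.toReal_ofReal hy.2.1]
      exact hy.2.2.2
  rw [← Measure.lintegral_condKernel hg.ennreal_ofReal, ← Measure.lintegral_condKernel hQ,
    ← lintegral_add_right _ hQ.lintegral_kernel_prod_right']
  exact lintegral_mono_ae hsec

/-- Potentials in contact with `π` certify its optimality on one component, without any
integrability of the potentials: the convex moderator `f` splits `c₁ + c₂ - c` into
nonnegative terms depending on `x`, on `y`, and a Jensen gap. -/
theorem lintegral_cost_le_of_potentials {c : ℝ × ℝ → ℝ≥0} (hc : UpperSemicontinuous c)
    {G : Set (ℝ × ℝ)} {I : Set ℝ} (hI : IsOpen I) (hIc : I.OrdConnected) (hne : I.Nonempty)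
    {φ ψ k : ℝ → ℝ}
    (hle : ∀ p ∈ G, ∀ q ∈ G, φ p.1 + ψ q.2 + k p.1 * (q.2 - p.1) ≤ c (p.1, q.2))
    (heq : ∀ p ∈ G, φ p.1 + ψ p.2 + k p.1 * (p.2 - p.1) = c p)
    (hcov : ∀ t ∈ I, ∃ x, t ∈ fibreHull G x) (hGI : ∀ p ∈ G, p.1 ∈ I ∧ p.2 ∈ closure I)
    {π π' : Measure (ℝ × ℝ)} [IsFiniteMeasure π] [IsFiniteMeasure π']
    (hπ : IsMartingaleMeasure π) (hπ' : IsMartingaleMeasure π') (hfst : π'.fst = π.fst)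
    (hsnd : π'.snd = π.snd) (hx : Integrable (fun x : ℝ => x) π.fst)
    (hy : Integrable (fun y : ℝ => y) π.snd) {c₁ c₂ : ℝ → ℝ} (hc₁m : Measurable c₁)
    (hc₂m : Measurable c₂) (hc₁ : Integrable c₁ π.fst) (hc₂ : Integrable c₂ π.snd)
    (hbound : ∀ p ∈ G, ∀ q ∈ G, (c (p.1, q.2) : ℝ) ≤ c₁ p.1 + c₂ q.2) (hG : ∀ᵐ p ∂π, p ∈ G) :
    ∫⁻ p, (c p : ℝ≥0∞) ∂π ≤ ∫⁻ p, (c p : ℝ≥0∞) ∂π' := by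
  set X : Set ℝ := {x | ∃ p ∈ G, p.1 = x} with hX
  set Y : Set ℝ := {y | ∃ p ∈ G, p.2 = y} with hY
  have hXae : ∀ᵐ x ∂π.fst, x ∈ X := ae_fst_of_ae (hG.mono fun p hp => ⟨p, hp, rfl⟩)
  have hYae : ∀ᵐ y ∂π.snd, y ∈ Y := ae_snd_of_ae (hG.mono fun p hp => ⟨p, hp, rfl⟩)
  have hψ : AEMeasurable ψ π.snd := aemeasurable_potential hc hle heq hYae
  have hXI : X ⊆ I := by rintro _ ⟨p, hp, rfl⟩; exact (hGI p hp).1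
  have hIY : ∀ t ∈ I, ∃ y₁ ∈ Y, ∃ y₂ ∈ Y, y₁ < t ∧ t < y₂ := by
    intro t ht
    obtain ⟨x, y₁, y₂, h1, h2, h3, h4⟩ := hcov t ht
    exact ⟨y₁, ⟨_, h1, rfl⟩, y₂, ⟨_, h2, rfl⟩, h3, h4⟩
  have : Nonempty G := by
    obtain ⟨t, ht⟩ := hne
    obtain ⟨x, y₁, y₂, h1, -⟩ := hcov t ht
    exact ⟨⟨_, h1⟩⟩
  obtain ⟨f, s, K, hIK, hYK, hlef, hfle, hT, hsup⟩ := exists_moderator (ι := G)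
    (α := fun p => φ p.1.1 - c₁ p.1.1 - k p.1.1 * p.1.1) (β := fun p => k p.1.1)
    (B := fun y => c₂ y - ψ y) hI hIc hne (Y := Y)
    (by rintro _ ⟨p, hp, rfl⟩; exact (hGI p hp).2) hIY (by
      rintro p _ ⟨q, hq, rfl⟩
      have h1 := hle p.1 p.2 q hq
      have h2 := hbound p.1 p.2 q hq
      linarith)
  obtain ⟨hfm, D, hDm, hD, hgap⟩ := exists_jensen_gap hI hIc hne hIK hT hsup
  have hvm : AEMeasurable (fun y => ENNReal.ofReal (c₂ y - ψ y - f y)) π.snd :=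
    ((hc₂m.aemeasurable.sub hψ).sub (hfm _ (hYae.mono hYK))).ennreal_ofReal
  set V := hvm.mk _ with hV
  set u : ℝ → ℝ := fun x => c₁ x - φ x + f x with hu
  set g : ℝ × ℝ → ℝ := fun p => c₁ p.1 + c₂ p.2 - c p with hg
  set Q : ℝ × ℝ → ℝ≥0∞ := fun p => V p.2 + D p with hQ
  have hcm : Measurable c := hc.measurable
  have hgm : Measurable g := by fun_prop
  have hVm : Measurable V := hvm.measurable_mk
  have hQm : Measurable Q := by fun_prop
  have hu0 : ∀ x ∈ X, 0 ≤ u x := by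
    rintro _ ⟨p, hp, rfl⟩
    have := hlef ⟨p, hp⟩ p.1 (hIK (hGI p hp).1)
    simp only [hu]
    linarith
  have hQval : ∀ᵐ y ∂π.snd, y ∈ Y ∧ ∀ x ∈ X, Q (x, y) ≠ ⊤ ∧
      u x + (Q (x, y)).toReal = c₁ x + c₂ y - φ x - ψ y - s x * (y - x) := by
    filter_upwards [hYae, hvm.ae_eq_mk] with y hyY hVy
    refine ⟨hyY, fun x hx => ?_⟩
    have h1 : 0 ≤ c₂ y - ψ y - f y := sub_nonneg.mpr (hfle y hyY)
    have h2 : 0 ≤ f y - tangentLine f s x y := sub_nonneg.mpr (hT x (hXI hx) y (hYK hyY))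
    simp only [hQ, hV, ← hVy, hD x (hXI hx) y (hYK hyY), ← ENNReal.ofReal_add h1 h2]
    refine ⟨ENNReal.ofReal_ne_top, ?_⟩
    rw [ENNReal.toReal_ofReal (add_nonneg h1 h2)]
    simp only [hu, tangentLine]
    ring
  have hg0 : ∀ x ∈ X, ∀ y ∈ Y, 0 ≤ g (x, y) := by
    rintro _ ⟨p, hp, rfl⟩ _ ⟨q, hq, rfl⟩
    exact sub_nonneg.mpr (hbound p hp q hq)
  have hup : ∫⁻ p, ENNReal.ofReal (g p) ∂π' ≤
      ∫⁻ x, ENNReal.ofReal (u x) ∂π'.fst + ∫⁻ p, Q p ∂π' := by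
    refine lintegral_le_lintegral_fst_add (m := fun x => s x - k x) hπ' hgm hQm ?_
    filter_upwards [ae_of_ae_fst (hfst ▸ hXae), ae_of_ae_snd (hsnd ▸ hQval)] with p hpX hpQ
    obtain ⟨h1, h2⟩ := hpQ.2 p.1 hpX
    refine ⟨h1, hg0 _ hpX _ hpQ.1, hu0 _ hpX, ?_⟩
    obtain ⟨⟨p', hp', e1⟩, q', hq', e2⟩ := And.intro hpX hpQ.1
    have h3 := hle p' hp' q' hq'
    rw [e1, e2] at h3
    rw [h2]
    simp only [hg]
    linarith
  have hlow : ∫⁻ x, ENNReal.ofReal (u x) ∂π.fst + ∫⁻ p, Q p ∂π ≤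
      ∫⁻ p, ENNReal.ofReal (g p) ∂π := by
    refine lintegral_fst_add_le (m := fun x => k x - s x) hπ hgm hQm ?_
    filter_upwards [hG, ae_of_ae_snd hQval] with p hpG hpQ
    have hpX : p.1 ∈ X := ⟨p, hpG, rfl⟩
    obtain ⟨h1, h2⟩ := hpQ.2 p.1 hpX
    refine ⟨h1, hg0 _ hpX _ hpQ.1, hu0 _ hpX, ?_⟩
    rw [h2]
    simp only [hg, ← heq p hpG]
    linarith
  have hQint : ∫⁻ p, Q p ∂π' ≤ ∫⁻ p, Q p ∂π := by
    have e : ∀ ρ : Measure (ℝ × ℝ), ∫⁻ p, Q p ∂ρ = ∫⁻ y, V y ∂ρ.snd + ∫⁻ p, D p ∂ρ := fun ρ => by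
      rw [hQ, lintegral_add_right _ hDm, Measure.snd, lintegral_map hVm measurable_snd]
    rw [e, e, hsnd]
    refine add_le_add le_rfl ?_
    exact hgap π π' inferInstance inferInstance hπ hπ' hfst hsnd hx hy
      (hG.mono fun p hp => ⟨(hGI p hp).1, hYK ⟨p, hp, rfl⟩⟩)
  have hgle : ∫⁻ p, ENNReal.ofReal (g p) ∂π' ≤ ∫⁻ p, ENNReal.ofReal (g p) ∂π := by
    refine hup.trans (le_trans ?_ hlow)
    rw [hfst]
    exact add_le_add le_rfl hQint
  -- The integral of `c + g = c₁ + c₂` is finite and the same for `π` and `π'`.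
  have htot : ∀ ρ : Measure (ℝ × ℝ), ρ.fst = π.fst → ρ.snd = π.snd →
      ∫⁻ p, (c p : ℝ≥0∞) ∂ρ + ∫⁻ p, ENNReal.ofReal (g p) ∂ρ =
        ENNReal.ofReal (∫ x, c₁ x ∂π.fst + ∫ y, c₂ y ∂π.snd) := by
    intro ρ h1 h2
    have i1 : Integrable c₁ ρ.fst := h1 ▸ hc₁
    have i2 : Integrable c₂ ρ.snd := h2 ▸ hc₂
    have hae : ∀ᵐ p ∂ρ, 0 ≤ g p := by
      filter_upwards [ae_of_ae_fst (h1 ▸ hXae), ae_of_ae_snd (h2 ▸ hYae)] with p hp1 hp2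
      exact hg0 _ hp1 _ hp2
    have i3 : Integrable (fun p : ℝ × ℝ => c₁ p.1 + c₂ p.2) ρ :=
      (integrable_comp_fst i1).add (integrable_comp_snd i2)
    rw [← h1, ← h2, ← integral_comp_fst i1, ← integral_comp_snd i2,
      ← integral_add (integrable_comp_fst i1) (integrable_comp_snd i2),
      ofReal_integral_eq_lintegral_ofReal i3 (hae.mono fun p hp => ?_),
      ← lintegral_add_right _ hgm.ennreal_ofReal]
    · refine lintegral_congr_ae (hae.mono fun p hp => ?_)
      beta_reduce
      rw [← ENNReal.ofReal_coe_nnreal, ← ENNReal.ofReal_add (c p).coe_nonneg hp]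
      simp [hg]
    · exact (c p).coe_nonneg.trans (sub_nonneg.mp hp)
  have e := (htot π rfl rfl).trans (htot π' hfst hsnd).symm
  have hfin : ∫⁻ p, ENNReal.ofReal (g p) ∂π ≠ ⊤ := by
    have := htot π rfl rfl
    exact ne_top_of_le_ne_top (this ▸ ENNReal.ofReal_ne_top) le_add_self
  exact (ENNReal.add_le_add_iff_right hfin).mp (e.trans_le (add_le_add le_rfl hgle))

/-! ### Components of the line -/

/-- A mean-zero increment that is not identically zero takes both signs: almost surely, either `x`
lies strictly between two points of the fibre `G_x`, or the mass at `x` does not move. -/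
theorem ae_mem_fibreHull {π : Measure (ℝ × ℝ)} [IsFiniteMeasure π] (hπ : IsMartingaleMeasure π)
    {G : Set (ℝ × ℝ)} (hG : ∀ᵐ p ∂π, p ∈ G) : ∀ᵐ p ∂π, p.1 ∈ fibreHull G p.1 ∨ p.2 = p.1 := by
  have hdiag : MeasurableSet {p : ℝ × ℝ | p.2 ≠ p.1} :=
    (measurableSet_eq_fun measurable_snd measurable_fst).compl
  set M : Set ℝ := {x | π.condKernel x {y | y ≠ x} = 0} with hM
  have hMm : MeasurableSet M :=
    ProbabilityTheory.Kernel.measurable_kernel_prodMk_left hdiag (measurableSet_singleton 0)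
  have h1 : ∀ᵐ x ∂π.fst, x ∈ fibreHull G x ∨ x ∈ M := by
    filter_upwards [ae_ae_condKernel hG, hπ.ae_integral_condKernel,
      hπ.integrable_sub.condKernel_ae] with x hx hmean hint
    refine or_iff_not_imp_left.mpr fun hhull => ?_
    have hsign : (∀ y, (x, y) ∈ G → x ≤ y) ∨ ∀ y, (x, y) ∈ G → y ≤ x := by
      by_contra hcon
      push Not at hcon
      obtain ⟨⟨y₁, h1, h2⟩, y₂, h3, h4⟩ := hcon
      exact hhull ⟨y₁, y₂, h1, h3, h2, h4⟩
    have hz : ∀ᵐ y ∂π.condKernel x, y = x := by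
      rcases hsign with h | h
      · have := (integral_eq_zero_iff_of_nonneg_ae
          (hx.mono fun y hy => sub_nonneg.mpr (h y hy)) hint).mp hmean
        exact this.mono fun y hy => sub_eq_zero.mp hy
      · have := (integral_eq_zero_iff_of_nonneg_ae (f := fun y => -(y - x))
          (hx.mono fun y hy => by simpa using h y hy) hint.neg).mp (by
            rw [integral_neg, hmean, neg_zero])
        exact this.mono fun y hy => sub_eq_zero.mp (neg_eq_zero.mp hy)
    exact hz
  have h2 : ∀ᵐ p ∂π, p.1 ∈ M → p.2 = p.1 := by
    rw [← π.disintegrate π.condKernel]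
    refine Measure.ae_compProd_of_ae_ae ?_ (Filter.Eventually.of_forall fun x => ?_)
    · have : {p : ℝ × ℝ | p.1 ∈ M → p.2 = p.1} = (Prod.fst ⁻¹' M)ᶜ ∪ {p | p.2 ≠ p.1}ᶜ := by
        ext p; simp [imp_iff_not_or]
      rw [this]
      exact (measurable_fst hMm).compl.union hdiag.compl
    · by_cases hx : x ∈ M
      · have hx' : ∀ᵐ y ∂π.condKernel x, y = x := hx
        exact hx'.mono fun y hy _ => hy
      · exact Filter.Eventually.of_forall fun y h => absurd h hx
  filter_upwards [ae_of_ae_fst h1, h2] with p hp1 hp2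
  exact hp1.imp id hp2

theorem fst_restrict_prod_univ (π : Measure (ℝ × ℝ)) {I : Set ℝ} (hI : MeasurableSet I) :
    (π.restrict (I ×ˢ Set.univ)).fst = π.fst.restrict I := by
  rw [Set.prod_univ, Measure.fst, Measure.fst, Measure.restrict_map measurable_fst hI]

theorem mem_fibreHull_of_between {G : Set (ℝ × ℝ)} {x y t : ℝ} (hx : x ∈ fibreHull G x)
    (hy : (x, y) ∈ G) (ht : x ≤ t ∧ t < y ∨ y < t ∧ t ≤ x) : t ∈ fibreHull G x := by
  obtain ⟨y₁, y₂, h1, h2, h3, h4⟩ := hx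
  rcases ht with ⟨ha, hb⟩ | ⟨ha, hb⟩
  · exact ⟨y₁, y, h1, hy, h3.trans_le ha, hb⟩
  · exact ⟨y, y₂, hy, h2, ha, hb.trans_lt h4⟩

theorem ordConnected_fibreHull (G : Set (ℝ × ℝ)) (x : ℝ) : (fibreHull G x).OrdConnected := by
  refine ⟨?_⟩
  rintro t ⟨y₁, -, h1, -, h3, -⟩ t' ⟨-, y₂, -, h2, -, h4⟩ z hz
  exact ⟨y₁, y₂, h1, h2, h3.trans_le hz.1, hz.2.trans_lt h4⟩

/-- Optimality on each component of the complement of `F` and immobility on `F` give optimality. -/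
theorem lintegral_le_of_components {π π' : Measure (ℝ × ℝ)} (hfst : π'.fst = π.fst) {F : Set ℝ}
    (hF : IsClosed F) {c : ℝ × ℝ → ℝ≥0∞} (hc : Measurable c)
    (hd : ∀ᵐ p ∂π, p.1 ∈ F → p.2 = p.1) (hd' : ∀ᵐ p ∂π', p.1 ∈ F → p.2 = p.1)
    (hcomp : ∀ q ∉ F, ∫⁻ p in Set.ordConnectedComponent Fᶜ q ×ˢ Set.univ, c p ∂π ≤
      ∫⁻ p in Set.ordConnectedComponent Fᶜ q ×ˢ Set.univ, c p ∂π') :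
    ∫⁻ p, c p ∂π ≤ ∫⁻ p, c p ∂π' := by
  have hFm : MeasurableSet F := hF.measurableSet
  have hFF : MeasurableSet (F ×ˢ (Set.univ : Set ℝ)) := hFm.prod MeasurableSet.univ
  have hdiag : ∀ ρ : Measure (ℝ × ℝ), (∀ᵐ p ∂ρ, p.1 ∈ F → p.2 = p.1) →
      ∫⁻ p in F ×ˢ Set.univ, c p ∂ρ = ∫⁻ x in F, c (x, x) ∂ρ.fst := by
    intro ρ hρ
    rw [Measure.fst, setLIntegral_map hFm (by fun_prop) measurable_fst, ← Set.prod_univ]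
    refine setLIntegral_congr_fun_ae hFF ?_
    filter_upwards [hρ] with p hp hpF
    exact congrArg c (Prod.ext rfl (hp hpF.1))
  set 𝒞 : Set (Set ℝ) := Set.ordConnectedComponent Fᶜ '' (Set.range ((↑) : ℚ → ℝ) ∩ Fᶜ) with h𝒞
  have h𝒞c : 𝒞.Countable := ((Set.countable_range _).mono Set.inter_subset_left).image _
  have h𝒞m : ∀ I ∈ 𝒞, MeasurableSet (I ×ˢ (Set.univ : Set ℝ)) := by
    rintro _ ⟨q, ⟨-, hq⟩, rfl⟩
    exact (isOpen_ordConnectedComponent_compl hF hq).measurableSet.prod MeasurableSet.univ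
  have hdisj : 𝒞.PairwiseDisjoint fun I => I ×ˢ (Set.univ : Set ℝ) := by
    rintro _ ⟨q, -, rfl⟩ _ ⟨q', -, rfl⟩ hne
    refine Set.disjoint_left.mpr fun p hp hp' => hne ?_
    exact (Set.ordConnectedComponent_eq hp.1).trans (Set.ordConnectedComponent_eq hp'.1).symm
  have hunion : (F ×ˢ (Set.univ : Set ℝ))ᶜ = ⋃ I ∈ 𝒞, I ×ˢ (Set.univ : Set ℝ) := by
    ext p
    simp only [Set.mem_compl_iff, Set.mem_prod, Set.mem_univ, and_true, Set.mem_iUnion, exists_prop]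
    constructor
    · intro hp
      obtain ⟨r, hr⟩ := Rat.denseRange_cast.exists_mem_open
        (isOpen_ordConnectedComponent_compl hF hp)
        ⟨p.1, Set.self_mem_ordConnectedComponent.mpr hp⟩
      exact ⟨_, ⟨r, ⟨⟨r, rfl⟩, Set.ordConnectedComponent_subset hr⟩, rfl⟩,
        Set.mem_ordConnectedComponent_comm.mp hr⟩
    · rintro ⟨_, ⟨q, -, rfl⟩, hp⟩
      exact Set.ordConnectedComponent_subset hp
  rw [← lintegral_add_compl c hFF (μ := π), ← lintegral_add_compl c hFF (μ := π'), hdiag π hd,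
    hdiag π' hd', hfst, hunion, lintegral_biUnion h𝒞c h𝒞m hdisj, lintegral_biUnion h𝒞c h𝒞m hdisj]
  refine add_le_add le_rfl (ENNReal.tsum_le_tsum ?_)
  rintro ⟨_, ⟨q, ⟨-, hq⟩, rfl⟩⟩
  exact hcomp q hq

end MartingaleTransport

open MartingaleTransport

theorem theorem1p3 (μ ν : Measure ℝ) [IsProbabilityMeasure μ] [IsProbabilityMeasure ν]
    (hμν : MartingaleTransport.ConvexOrder μ ν)
    (c : ℝ × ℝ → ℝ≥0) (hc : UpperSemicontinuous c)
    (c₁ c₂ : ℝ → ℝ) (hc₁ : Integrable c₁ μ) (hc₂ : Integrable c₂ ν)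
    (A B : Set ℝ) (hA : MeasurableSet A) (hB : MeasurableSet B) (hμA : μ A = 1) (hνB : ν B = 1)
    (hbound : ∀ x ∈ A, ∀ y ∈ B, (c (x, y) : ℝ) ≤ c₁ x + c₂ y)
    (π : Measure (ℝ × ℝ)) (hπ : MartingaleTransport.IsMartingaleTransport μ ν π)
    (hfin : MartingaleTransport.IsFinitelyOptimal c π) :
    MartingaleTransport.IsOptimal c μ ν π := by
  refine ⟨hπ, fun π' hπ' => ?_⟩
  have hprob : ∀ ρ : Measure (ℝ × ℝ), IsMartingaleTransport μ ν ρ → IsProbabilityMeasure ρ :=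
    fun ρ hρ => ⟨by rw [← Measure.fst_univ, hρ.fst_eq, measure_univ]⟩
  have := hprob π hπ
  have := hprob π' hπ'
  have hm := hπ.isMartingaleMeasure
  have hm' := hπ'.isMartingaleMeasure
  have hfst : π'.fst = π.fst := hπ'.fst_eq.trans hπ.fst_eq.symm
  have hsnd : π'.snd = π.snd := hπ'.snd_eq.trans hπ.snd_eq.symm
  have hx : Integrable (fun x : ℝ => x) π.fst := hπ.fst_eq ▸ hμν.1
  have hy : Integrable (fun y : ℝ => y) π.snd := hπ.snd_eq ▸ hμν.2.1
  obtain ⟨Γ, hΓm, hΓ, hπΓ⟩ := hfin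
  -- Borel versions of `c₁` and `c₂`.
  set d₁ := hc₁.aestronglyMeasurable.mk c₁ with hd₁
  set d₂ := hc₂.aestronglyMeasurable.mk c₂ with hd₂
  have hd₁m : Measurable d₁ := hc₁.aestronglyMeasurable.stronglyMeasurable_mk.measurable
  have hd₂m : Measurable d₂ := hc₂.aestronglyMeasurable.stronglyMeasurable_mk.measurable
  have hd₁i : Integrable d₁ π.fst :=
    hπ.fst_eq ▸ hc₁.congr hc₁.aestronglyMeasurable.ae_eq_mk
  have hd₂i : Integrable d₂ π.snd :=
    hπ.snd_eq ▸ hc₂.congr hc₂.aestronglyMeasurable.ae_eq_mk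
  set Γ₀ : Set (ℝ × ℝ) := {p | p ∈ Γ ∧ (p.1 ∈ A ∧ c₁ p.1 = d₁ p.1) ∧ p.2 ∈ B ∧ c₂ p.2 = d₂ p.2}
    with hΓ₀
  have hΓ₀ae : ∀ᵐ p ∂π, p ∈ Γ₀ := by
    have e1 : ∀ᵐ x ∂π.fst, x ∈ A ∧ c₁ x = d₁ x := by
      rw [hπ.fst_eq]
      exact Filter.Eventually.and ((prob_compl_eq_zero_iff hA).mpr hμA : ∀ᵐ x ∂μ, x ∈ A)
        hc₁.aestronglyMeasurable.ae_eq_mk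
    have e2 : ∀ᵐ y ∂π.snd, y ∈ B ∧ c₂ y = d₂ y := by
      rw [hπ.snd_eq]
      exact Filter.Eventually.and ((prob_compl_eq_zero_iff hB).mpr hνB : ∀ᵐ y ∂ν, y ∈ B)
        hc₂.aestronglyMeasurable.ae_eq_mk
    filter_upwards [((prob_compl_eq_zero_iff hΓm).mpr hπΓ : ∀ᵐ p ∂π, p ∈ Γ), ae_of_ae_fst e1,
      ae_of_ae_snd e2] with p h1 h2 h3 using ⟨h1, h2, h3⟩
  -- `F` consists of the levels that the mass of `π` does not cross.
  set F : Set ℝ := (⋃ x ∈ {x | x ∈ fibreHull Γ₀ x}, fibreHull Γ₀ x)ᶜ with hFdef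
  have hF : IsClosed F := (isOpen_biUnion fun x _ => isOpen_fibreHull Γ₀ x).isClosed_compl
  have hhullF : ∀ {x t}, x ∈ fibreHull Γ₀ x → t ∈ fibreHull Γ₀ x → t ∉ F := fun h1 h2 h3 =>
    h3 (Set.mem_biUnion (show _ ∈ {x | x ∈ fibreHull Γ₀ x} from h1) h2)
  have hFhull : ∀ {t}, t ∉ F → ∃ x, x ∈ fibreHull Γ₀ x ∧ t ∈ fibreHull Γ₀ x := fun h => by
    simpa [hFdef] using h
  set Γ₁ : Set (ℝ × ℝ) := {p | p ∈ Γ₀ ∧ (p.1 ∈ fibreHull Γ₀ p.1 ∨ p.2 = p.1)} with hΓ₁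
  have hΓ₁ae : ∀ᵐ p ∂π, p ∈ Γ₁ := by
    filter_upwards [hΓ₀ae, ae_mem_fibreHull hm hΓ₀ae] with p h1 h2 using ⟨h1, h2⟩
  have hnc : ∀ᵐ p ∂π, ∀ t ∈ F, NoCrossing t p := by
    filter_upwards [hΓ₁ae] with p hp t ht
    rcases hp.2 with h | h
    · constructor
      · intro hxt
        by_contra hty
        exact hhullF h (mem_fibreHull_of_between h hp.1 (Or.inl ⟨hxt, not_le.mp hty⟩)) ht
      · intro hxt
        by_contra hty
        exact hhullF h (mem_fibreHull_of_between h hp.1 (Or.inr ⟨not_le.mp hty, hxt⟩)) ht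
    · simp [NoCrossing, h]
  have hnc' : ∀ᵐ p ∂π', ∀ t ∈ F, NoCrossing t p := ae_forall_noCrossing hF fun t ht =>
    ae_noCrossing_of_marginals hm hm' hfst hsnd hx hy (hnc.mono fun p hp => hp t ht)
  have hfix : ∀ p : ℝ × ℝ, (∀ t ∈ F, NoCrossing t p) → p.1 ∈ F → p.2 = p.1 := fun p hp h =>
    le_antisymm ((hp _ h).1 le_rfl) ((hp _ h).2 le_rfl)
  refine lintegral_le_of_components hfst hF hc.measurable.coe_nnreal_ennreal (hnc.mono hfix)
    (hnc'.mono hfix) fun q hq => ?_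
  set I := Set.ordConnectedComponent Fᶜ q with hI
  have hIo : IsOpen I := isOpen_ordConnectedComponent_compl hF hq
  have hIm : MeasurableSet I := hIo.measurableSet
  have hIc : I.OrdConnected := inferInstance
  have hIne : I.Nonempty := ⟨q, Set.self_mem_ordConnectedComponent.mpr hq⟩
  -- A fibre hull that meets the component lies in it.
  have hhullI : ∀ {x t z}, x ∈ fibreHull Γ₀ x → t ∈ fibreHull Γ₀ x → t ∈ I →
      z ∈ fibreHull Γ₀ x → z ∈ I := fun {x t z} h1 h2 h3 h4 =>
    Set.mem_ordConnectedComponent_trans h3 (Set.mem_ordConnectedComponent.mpr fun w hw =>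
      hhullF h1 ((ordConnected_fibreHull Γ₀ x).uIcc_subset h2 h4 hw))
  set G : Set (ℝ × ℝ) := {p | p ∈ Γ₁ ∧ p.1 ∈ I} with hG
  have hGhull : ∀ {x t}, x ∈ fibreHull Γ₀ x → x ∈ I → t ∈ fibreHull Γ₀ x → t ∈ fibreHull G x := by
    rintro x t h1 h2 ⟨y₁, y₂, h3, h4, h5, h6⟩
    exact ⟨y₁, y₂, ⟨⟨h3, Or.inl h1⟩, h2⟩, ⟨⟨h4, Or.inl h1⟩, h2⟩, h5, h6⟩
  have hcov : ∀ t ∈ I, ∃ x, t ∈ fibreHull G x := by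
    intro t ht
    obtain ⟨x, h1, h2⟩ := hFhull (Set.ordConnectedComponent_subset ht)
    exact ⟨x, hGhull h1 (hhullI h1 h2 ht h1) h2⟩
  have hGI : ∀ p ∈ G, p.1 ∈ I ∧ p.2 ∈ closure I := by
    rintro ⟨x, y⟩ ⟨⟨h1, h2⟩, h3⟩
    refine ⟨h3, ?_⟩
    rcases lt_trichotomy x y with hxy | hxy | hxy
    · have h4 := h2.resolve_right hxy.ne'
      have hsub : Set.Ioo x y ⊆ I := fun t ht => hhullI h4 h4 h3
        (mem_fibreHull_of_between h4 h1 (Or.inl ⟨ht.1.le, ht.2⟩))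
      refine closure_mono hsub ?_
      rw [closure_Ioo hxy.ne]
      exact ⟨hxy.le, le_rfl⟩
    · exact subset_closure (hxy ▸ h3)
    · have h4 := h2.resolve_right hxy.ne
      have hsub : Set.Ioo y x ⊆ I := fun t ht => hhullI h4 h4 h3
        (mem_fibreHull_of_between h4 h1 (Or.inr ⟨ht.1, ht.2.le⟩))
      refine closure_mono hsub ?_
      rw [closure_Ioo hxy.ne]
      exact ⟨le_rfl, hxy.le⟩
  obtain ⟨φ, ψ, k, hle, heq⟩ := hΓ.exists_potentials (G := G) (I := I) (fun p hp => hp.1.1.1)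
    hIc.isPreconnected hIne hcov (fun p hp => (hGI p hp).1)
    (fun p hp => hp.1.2.imp (fun h => hGhull h hp.2 h) id)
  have hfle : (π.restrict (I ×ˢ Set.univ)).fst ≤ π.fst :=
    Measure.map_mono Measure.restrict_le_self measurable_fst
  have hsle : (π.restrict (I ×ˢ Set.univ)).snd ≤ π.snd :=
    Measure.map_mono Measure.restrict_le_self measurable_snd
  refine lintegral_cost_le_of_potentials hc hIo hIc hIne hle heq hcov hGI (hm.restrict hIm)
    (hm'.restrict hIm) ?_ (snd_restrict_component_eq hfst hsnd hF hnc hnc' hq)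
    (hx.mono_measure hfle) (hy.mono_measure hsle) hd₁m hd₂m (hd₁i.mono_measure hfle)
    (hd₂i.mono_measure hsle) ?_ ?_
  · rw [fst_restrict_prod_univ _ hIm, fst_restrict_prod_univ _ hIm, hfst]
  · rintro p ⟨⟨⟨-, ⟨h1, h2⟩, -⟩, -⟩, -⟩ q ⟨⟨⟨-, -, h3, h4⟩, -⟩, -⟩
    rw [← h2, ← h4]
    exact hbound _ h1 _ h3
  · filter_upwards [ae_restrict_of_ae hΓ₁ae,
      ae_restrict_mem (hIm.prod MeasurableSet.univ)] with p h1 h2 using ⟨h1, h2.1⟩
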